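/- Let $\tilde{\mathcal A}=\{\sum_{\nu\ge 0}P_\nu(a)\,b^\nu : P_\nu\in\mathbb C[z]\}$ be the $\mathbb C$-algebra with the commutation relation $ab-ba=b^2$ in which left and right multiplication by $a$ are continuous for the $b$-adic topology; it contains $\mathbb C[[b]]$. An (a,b)-module is a left $\tilde{\mathcal A}$-module which is free of finite type over $\mathbb C[[b]]$; its rank is its rank over $\mathbb C[[b]]$. It is monogenic if it is isomorphic to $\tilde{\mathcal A}/I$ for a left ideal $I$, and regular if it embeds in an (a,b)-module $F$ with $aF\subset bF$ (equivalently, its saturation by $b^{-1}a$ is of finite type over $\mathbb C[[b]]$). A submodule $F\subset E$ is normal if $F\cap bE=bF$. Let $E$ be a regular monogenic (a,b)-module of rank $k$. Its Bernstein element is the element $P_E=\sum_{j=0}^k c_j a^jb^{k-j}$, with $c_j\in\mathbb C$ and $c_k=1$, such that $E$ has a generator whose annihilator is the left ideal generated by $P_E+b^2R$ for some polynomial $R$ in $a$, of degree at most $k-1$, with coefficients in $\mathbb C[[b]]$, all of whose monomials $a^ib^n$ satisfy $i+n\ge k-1$. The twisted orbit of $(\lambda_1,\dots,\lambda_k)\in\mathbb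 C^k$ is the set of the $k$-tuples $(\lambda_{\sigma(1)}+\sigma(1)-1,\dots,\lambda_{\sigma(k)}+\sigma(k)-k)$ with $\sigma\in\mathfrak S_k$. Suppose that $P_E=(a-\lambda_1b)(a-\lambda_2b)\cdots(a-\lambda_kb)$. 1. Let $(\mu_1,\dots,\mu_k)$ be an element of the twisted orbit of $(\lambda_1,\dots,\lambda_k)$ such that $$\Re(\mu_1)+1\le \Re(\mu_2)+2\le\cdots\le\Re(\mu_k)+k .$$ Then there are $T_1,\dots,T_{k-1}\in\mathbb C[[b]]$ with $T_j(0)=1$ for all $j$, and a generator $e$ of $E$ over $\tilde{\mathcal A}$ whose annihilator is the left ideal $\tilde{\mathcal A}Q$, where $$Q=(a-\mu_1b)\,T_1^{-1}(a-\mu_2b)\,T_2^{-1}\cdots(a-\mu_{k-1}b)\,T_{k-1}^{-1}(a-\mu_kb).$$ 2. Suppose moreover that $E$ has no rank 2 subquotient $F/G$, with $G\subset F\subset E$ normal submodules, isomorphic to $$E_{\lambda,\lambda-n}(\alpha)=\tilde{\mathcal A}\big/\tilde{\mathcal A}\,(a-(\lambda-n)b)(1+\alpha b^n)^{-1}(a-(\lambda-1)b)$$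 for some $\lambda\in\mathbb C$, $\alpha\in\mathbb C\setminus\{0\}$ and integer $n\ge1$. Then for every $(\nu_1,\dots,\nu_k)$ in the twisted orbit of $(\lambda_1,\dots,\lambda_k)$ there are $X_1,\dots,X_{k-1}\in\mathbb C[[b]]$ with $X_j(0)=1$ for all $j$, and a generator of $E$ over $\tilde{\mathcal A}$ whose annihilator is the left ideal $\tilde{\mathcal A}R$, where $$R=(a-\nu_1b)\,X_1^{-1}(a-\nu_2b)\,X_2^{-1}\cdots(a-\nu_{k-1}b)\,X_{k-1}^{-1}(a-\nu_kb).$$ -/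

import Mathlib

noncomputable section

/-- The underlying space of the algebra `Ã`: the sequence `p` stands for the series
`∑ ν, (p ν)(a) b ^ ν`, where each `p ν` is a polynomial in `a`. -/
@[ext] structure ATilde : Type where
  /-- The polynomial coefficients of the series. -/
  coeff : ℕ → Polynomial ℂ

namespace ATilde

instance : CoeFun ATilde fun _ => ℕ → Polynomial ℂ := ⟨coeff⟩

theorem ext' {p q : ATilde} (h : ∀ n, p n = q n) : p = q := ATilde.ext (funext h)

/-- A series as the sequence of its coefficients. -/
def equivFun : ATilde ≃ (ℕ → Polynomial ℂ) := ⟨coeff, mk, fun _ => rfl, fun _ => rfl⟩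

/- Addition and multiplication by complex numbers are coefficientwise. -/
instance : AddCommGroup ATilde := equivFun.addCommGroup
instance : Module ℂ ATilde := equivFun.module ℂ

@[simp] theorem mk_apply (f : ℕ → Polynomial ℂ) (n : ℕ) : (mk f) n = f n := rfl
@[simp] theorem add_apply (p q : ATilde) (n : ℕ) : (p + q) n = p n + q n := rfl
@[simp] theorem sub_apply (p q : ATilde) (n : ℕ) : (p - q) n = p n - q n := rfl
@[simp] theorem neg_apply (p : ATilde) (n : ℕ) : (-p) n = -p n := rfl
@[simp] theorem zero_apply (n : ℕ) : (0 : ATilde) n = 0 := rfl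
@[simp] theorem smul_apply (c : ℂ) (p : ATilde) (n : ℕ) : (c • p) n = c • p n := rfl

/-- The coefficient in `b ^ ν Q(a) = ∑ j, bCoeff ν j • Q^(j)(a) b ^ (ν + j)`, which is forced
by `a b - b a = b ^ 2`; it is the binomial coefficient of `-ν` over `j`. -/
def bCoeff (ν j : ℕ) : ℂ := (-1) ^ j * (Nat.multichoose ν j : ℂ)

/-- The product `(∑ (p ν)(a) b ^ ν) (∑ (q l)(a) b ^ l)`, where the powers of `b` are moved to
the right of the powers of `a`. -/
def mulFun (p q : ATilde) : ATilde := .mk fun n =>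
  ∑ x ∈ Finset.HasAntidiagonal.antidiagonal n, ∑ y ∈ Finset.HasAntidiagonal.antidiagonal x.2,
    p x.1 * (bCoeff x.1 y.1 • Polynomial.derivative^[y.1] (q y.2))

instance : Mul ATilde := ⟨mulFun⟩
instance : One ATilde := ⟨.mk fun n => if n = 0 then 1 else 0⟩

theorem mul_apply (p q : ATilde) (n : ℕ) : (p * q) n =
    ∑ x ∈ Finset.HasAntidiagonal.antidiagonal n, ∑ y ∈ Finset.HasAntidiagonal.antidiagonal x.2,
      p x.1 * (bCoeff x.1 y.1 • Polynomial.derivative^[y.1] (q y.2)) := rfl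

theorem one_apply (n : ℕ) : (1 : ATilde) n = if n = 0 then 1 else 0 := rfl

theorem bCoeff_zero_right (ν : ℕ) : bCoeff ν 0 = 1 := by simp [bCoeff]

theorem bCoeff_zero_left (j : ℕ) : bCoeff 0 j = if j = 0 then 1 else 0 := by
  cases j <;> simp [bCoeff]

theorem bCoeff_succ (ν j : ℕ) :
    ((j : ℂ) + 1) * bCoeff ν (j + 1) = -((ν : ℂ) + j) * bCoeff ν j := by
  have h : (j + 1) * Nat.multichoose ν (j + 1) = (ν + j) * Nat.multichoose ν j := by
    rcases ν with _ | ν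
    · cases j <;> simp
    · rw [Nat.multichoose_eq, Nat.multichoose_eq]
      have := Nat.add_one_mul_choose_eq (ν + j) j
      simp only [show ν + 1 + (j + 1) - 1 = ν + j + 1 by omega,
        show ν + 1 + j - 1 = ν + j by omega]
      rw [show ν + 1 + j = ν + j + 1 by omega]
      linarith
  have h' : ((j : ℂ) + 1) * (Nat.multichoose ν (j + 1) : ℂ)
      = ((ν : ℂ) + j) * (Nat.multichoose ν j : ℂ) := by exact_mod_cast h
  simp only [bCoeff, pow_succ]
  linear_combination (-(-1 : ℂ) ^ j) * h'

protected theorem mul_add' (p q r : ATilde) : p * (q + r) = p * q + p * r := by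
  refine ext' fun n => ?_
  simp [mul_apply, mul_add, Finset.sum_add_distrib, iterate_map_add]

protected theorem add_mul' (p q r : ATilde) : (p + q) * r = p * r + q * r := by
  refine ext' fun n => ?_
  simp [mul_apply, add_mul, Finset.sum_add_distrib]

protected theorem mul_smul' (c : ℂ) (p q : ATilde) : p * (c • q) = c • (p * q) := by
  refine ext' fun n => ?_
  simp only [mul_apply, smul_apply, Finset.smul_sum, Polynomial.iterate_derivative_smul]
  refine Finset.sum_congr rfl fun x _ => Finset.sum_congr rfl fun y _ => ?_
  rw [smul_comm, mul_smul_comm]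

protected theorem smul_mul' (c : ℂ) (p q : ATilde) : (c • p) * q = c • (p * q) := by
  refine ext' fun n => ?_
  simp only [mul_apply, smul_apply, Finset.smul_sum, smul_mul_assoc]

protected theorem one_mul' (q : ATilde) : 1 * q = q := by
  refine ext' fun n => ?_
  rw [mul_apply, Finset.sum_eq_single (0, n), Finset.sum_eq_single (0, n)]
  · simp [one_apply, bCoeff_zero_left]
  · rintro ⟨i, j⟩ h hne
    have : i ≠ 0 := by rintro rfl; simp_all
    simp [bCoeff_zero_left, this]
  · simp
  · rintro ⟨i, j⟩ h hne
    have : i ≠ 0 := by rintro rfl; simp_all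
    simp [one_apply, this]
  · simp

protected theorem mul_one' (p : ATilde) : p * 1 = p := by
  refine ext' fun n => ?_
  rw [mul_apply, Finset.sum_eq_single (n, 0)]
  · simp [one_apply, bCoeff_zero_right]
  · rintro ⟨i, m⟩ h hne
    refine Finset.sum_eq_zero ?_
    rintro ⟨j, l⟩ hy
    have hm : m ≠ 0 := by rintro rfl; simp_all
    by_cases hl : l = 0
    · subst hl
      have hj : 0 < j := by simp at hy; omega
      simp [one_apply, Polynomial.iterate_derivative_one hj]
    · simp [one_apply, hl]
  · simp

/-- Shift of a sequence, with value `0` at `0`. -/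
def shift (f : ℕ → Polynomial ℂ) : ℕ → Polynomial ℂ
  | 0 => 0
  | n + 1 => f n

@[simp] theorem shift_zero (f : ℕ → Polynomial ℂ) : shift f 0 = 0 := rfl
@[simp] theorem shift_succ (f : ℕ → Polynomial ℂ) (n : ℕ) : shift f (n + 1) = f n := rfl

/-- Right multiplication by `b`. -/
def rightB (p : ATilde) : ATilde := .mk (shift p)

/-- Right multiplication by `a`. -/
def rightA (p : ATilde) : ATilde := .mk fun n =>
  Polynomial.X * p n - shift (fun m => (m : ℂ) • p m) n

theorem mul_rightB (p q : ATilde) : p * rightB q = rightB (p * q) := by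
  refine ext' fun n => ?_
  rcases n with _ | n
  · simp [mul_apply, rightB]
  · show _ = (p * q) n
    rw [mul_apply, mul_apply, Finset.Nat.sum_antidiagonal_succ']
    simp only [Finset.Nat.antidiagonal_zero, Finset.sum_singleton, Function.iterate_zero, id]
    have h0 : rightB q 0 = 0 := rfl
    rw [h0, smul_zero, mul_zero]
    simp only [zero_add]
    refine Finset.sum_congr rfl fun x _ => ?_
    rw [Finset.Nat.sum_antidiagonal_succ']
    simp [h0]
    rfl

theorem rightA_apply (q : ATilde) (l : ℕ) :
    rightA q l = Polynomial.X * q l - shift (fun m => (m : ℂ) • q m) l := rfl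

theorem iterate_derivative_rightA (q : ATilde) (j l : ℕ) :
    Polynomial.derivative^[j] (rightA q l)
      = Polynomial.X * Polynomial.derivative^[j] (q l)
        + (j : ℂ) • Polynomial.derivative^[j - 1] (q l)
        - shift (fun m => (m : ℂ) • Polynomial.derivative^[j] (q m)) l := by
  rw [rightA_apply, Polynomial.iterate_derivative_sub, mul_comm,
    Polynomial.iterate_derivative_mul_X, mul_comm]
  cases l <;> simp [Nat.cast_smul_eq_nsmul]

theorem sum_rightA (q : ATilde) (ν m : ℕ) :
    (∑ y ∈ Finset.HasAntidiagonal.antidiagonal (m + 1),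
        bCoeff ν y.1 • Polynomial.derivative^[y.1] (rightA q y.2))
      = Polynomial.X * (∑ y ∈ Finset.HasAntidiagonal.antidiagonal (m + 1),
          bCoeff ν y.1 • Polynomial.derivative^[y.1] (q y.2))
        - ((ν : ℂ) + m) • ∑ y ∈ Finset.HasAntidiagonal.antidiagonal m,
          bCoeff ν y.1 • Polynomial.derivative^[y.1] (q y.2) := by
  have e1 : (∑ y ∈ Finset.HasAntidiagonal.antidiagonal (m + 1),
      bCoeff ν y.1 • ((y.1 : ℂ) • Polynomial.derivative^[y.1 - 1] (q y.2)))
      = ∑ y ∈ Finset.HasAntidiagonal.antidiagonal m,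
        (-((ν : ℂ) + y.1) * bCoeff ν y.1) • Polynomial.derivative^[y.1] (q y.2) := by
    rw [Finset.Nat.sum_antidiagonal_succ]
    simp only [Nat.cast_zero, zero_smul, smul_zero, zero_add, Nat.add_sub_cancel]
    refine Finset.sum_congr rfl fun y _ => ?_
    rw [smul_smul, ← bCoeff_succ]
    push_cast
    rw [mul_comm (bCoeff _ _)]
  have e2 : (∑ y ∈ Finset.HasAntidiagonal.antidiagonal (m + 1),
      bCoeff ν y.1 • shift (fun m => (m : ℂ) • Polynomial.derivative^[y.1] (q m)) y.2)
      = ∑ y ∈ Finset.HasAntidiagonal.antidiagonal m,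
        ((y.2 : ℂ) * bCoeff ν y.1) • Polynomial.derivative^[y.1] (q y.2) := by
    rw [Finset.Nat.sum_antidiagonal_succ']
    simp only [shift_zero, shift_succ, smul_zero, zero_add]
    refine Finset.sum_congr rfl fun y _ => ?_
    rw [smul_smul, mul_comm (bCoeff _ _)]
  have e3 : ((ν : ℂ) + m) • (∑ y ∈ Finset.HasAntidiagonal.antidiagonal m,
          bCoeff ν y.1 • Polynomial.derivative^[y.1] (q y.2))
      = (∑ y ∈ Finset.HasAntidiagonal.antidiagonal m,
          ((y.2 : ℂ) * bCoeff ν y.1) • Polynomial.derivative^[y.1] (q y.2))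
        - ∑ y ∈ Finset.HasAntidiagonal.antidiagonal m,
          (-((ν : ℂ) + y.1) * bCoeff ν y.1) • Polynomial.derivative^[y.1] (q y.2) := by
    rw [← Finset.sum_sub_distrib, Finset.smul_sum]
    refine Finset.sum_congr rfl fun y hy => ?_
    have hm : (m : ℂ) = y.1 + y.2 := by
      rw [← Finset.HasAntidiagonal.mem_antidiagonal.mp hy]; push_cast; rfl
    rw [← sub_smul, smul_smul, hm]
    congr 1
    ring
  simp only [iterate_derivative_rightA, smul_add, smul_sub, Finset.sum_add_distrib,
    Finset.sum_sub_distrib, mul_smul_comm, Finset.mul_sum]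
  rw [e1, e2, e3]
  abel

theorem mul_rightA (p q : ATilde) : p * rightA q = rightA (p * q) := by
  have hmul : ∀ (r : ATilde) (n : ℕ), (p * r) n =
      ∑ x ∈ Finset.HasAntidiagonal.antidiagonal n,
        p x.1 * ∑ y ∈ Finset.HasAntidiagonal.antidiagonal x.2,
          bCoeff x.1 y.1 • Polynomial.derivative^[y.1] (r y.2) := by
    intro r n
    rw [mul_apply]
    exact Finset.sum_congr rfl fun x _ => (Finset.mul_sum _ _ _).symm
  refine ext' fun n => ?_
  rw [rightA_apply]
  rcases n with _ | n
  · rw [hmul, hmul]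
    simp only [Finset.Nat.antidiagonal_zero, Finset.sum_singleton, Function.iterate_zero, id,
      shift_zero, sub_zero, rightA_apply, bCoeff_zero_right, one_smul]
    ring
  · rw [shift_succ, hmul, hmul, hmul, Finset.Nat.sum_antidiagonal_succ',
      Finset.Nat.sum_antidiagonal_succ', mul_add, Finset.mul_sum _ _ Polynomial.X, Finset.smul_sum,
      add_sub_assoc, ← Finset.sum_sub_distrib]
    congr 1
    · simp only [Finset.Nat.antidiagonal_zero, Finset.sum_singleton, Function.iterate_zero, id,
        shift_zero, sub_zero, rightA_apply, bCoeff_zero_right, one_smul]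
      ring
    · refine Finset.sum_congr rfl fun x hx => ?_
      have hn : (x.1 : ℂ) + x.2 = n := by
        rw [← Finset.HasAntidiagonal.mem_antidiagonal.mp hx]; push_cast; rfl
      rw [sum_rightA, hn, mul_sub, mul_smul_comm, mul_left_comm]

/-- A linear map commuting with right multiplication by `a` and by `b` and killing `1` is `0`. -/
theorem eq_zero_of_commutes (T : ATilde →ₗ[ℂ] ATilde) (h1 : T 1 = 0)
    (hB : ∀ r, T (rightB r) = rightB (T r)) (hA : ∀ r, T (rightA r) = rightA (T r))
    (r : ATilde) : T r = 0 := by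
  let s : Polynomial ℂ →ₗ[ℂ] ATilde :=
    { toFun := fun f => .mk fun n => if n = 0 then f else 0
      map_add' := fun f g => by
        refine ext' fun n => ?_; show (if n = 0 then f + g else 0) = (if n = 0 then f else 0) + (if n = 0 then g else 0)
        split_ifs <;> simp
      map_smul' := fun c f => by
        refine ext' fun n => ?_; show (if n = 0 then c • f else 0) = c • (if n = 0 then f else 0)
        split_ifs <;> simp }
  have hs : ∀ k : ℕ, T (s (Polynomial.X ^ k)) = 0 := by
    intro k
    induction k with
    | zero =>
      have : s (Polynomial.X ^ 0) = 1 := by refine ext' fun n => ?_; show (if n = 0 then _ else _) = _; simp [one_apply]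
      rw [this, h1]
    | succ k ih =>
      have : s (Polynomial.X ^ (k + 1)) = rightA (s (Polynomial.X ^ k)) := by
        refine ext' fun n => ?_
        rcases n with _ | _ | n
        · show Polynomial.X ^ (k + 1) = Polynomial.X * Polynomial.X ^ k - 0
          ring
        · show (0 : Polynomial ℂ) = Polynomial.X * 0 - ((0 : ℕ) : ℂ) • Polynomial.X ^ k
          simp
        · show (0 : Polynomial ℂ) = Polynomial.X * 0 - ((n + 1 : ℕ) : ℂ) • (0 : Polynomial ℂ)
          simp
      rw [this, hA, ih]
      refine ext' fun n => ?_
      cases n <;> simp [rightA]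
  have hs' : ∀ f, T (s f) = 0 := by
    intro f
    have : T.comp s = 0 := by
      refine Polynomial.lhom_ext' fun k => LinearMap.ext_ring ?_
      simpa [Polynomial.X_pow_eq_monomial] using hs k
    exact LinearMap.congr_fun this f
  have hn : ∀ (n : ℕ) (r : ATilde), (T r) n = 0 := by
    intro n
    induction n with
    | zero =>
      intro r
      have : r = s (r 0) + rightB (.mk fun n => r (n + 1)) := by
        refine ext' fun n => ?_; cases n <;> simp [s, rightB]
      rw [this, map_add, hs', hB, zero_add]; rfl
    | succ n ih =>
      intro r
      have : r = s (r 0) + rightB (.mk fun n => r (n + 1)) := by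
        refine ext' fun n => ?_; cases n <;> simp [s, rightB]
      rw [this, map_add, hs', hB, zero_add]
      exact ih _
  exact ext' fun n => hn n r

protected theorem mul_assoc' (p q r : ATilde) : p * q * r = p * (q * r) := by
  let T : ATilde →ₗ[ℂ] ATilde :=
    { toFun := fun r => p * q * r - p * (q * r)
      map_add' := fun x y => by simp only [ATilde.mul_add']; abel
      map_smul' := fun c x => by simp only [ATilde.mul_smul', RingHom.id_apply, smul_sub] }
  have hB : ∀ x y : ATilde, rightB x - rightB y = rightB (x - y) := by
    intro x y; refine ext' fun n => ?_; cases n <;> simp [rightB]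
  have hA : ∀ x y : ATilde, rightA x - rightA y = rightA (x - y) := by
    intro x y; refine ext' fun n => ?_; cases n
    · simp [rightA, mul_sub]
    · simp only [rightA, mk_apply, shift_succ, sub_apply, mul_sub, smul_sub]; abel
  have := eq_zero_of_commutes T
    (by show p * q * 1 - p * (q * 1) = 0
        rw [ATilde.mul_one', ATilde.mul_one', sub_self])
    (fun r => by
      show p * q * rightB r - p * (q * rightB r) = _
      rw [mul_rightB, mul_rightB, mul_rightB, hB]; rfl)
    (fun r => by
      show p * q * rightA r - p * (q * rightA r) = _
      rw [mul_rightA, mul_rightA, mul_rightA, hA]; rfl) r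
  exact sub_eq_zero.mp this

instance : Ring ATilde :=
  { (inferInstance : AddCommGroup ATilde), (inferInstance : Mul ATilde),
    (inferInstance : One ATilde) with
    left_distrib := ATilde.mul_add'
    right_distrib := ATilde.add_mul'
    mul_assoc := ATilde.mul_assoc'
    one_mul := ATilde.one_mul'
    mul_one := ATilde.mul_one'
    zero_mul := fun p => by refine ext' fun n => ?_; simp [mul_apply]
    mul_zero := fun p => by refine ext' fun n => ?_; simp [mul_apply] }

instance : Algebra ℂ ATilde := Algebra.ofModule ATilde.smul_mul' ATilde.mul_smul'

/-- The generator `a` of `Ã`. -/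
def a : ATilde := .mk fun n => if n = 0 then Polynomial.X else 0

/-- The generator `b` of `Ã`. -/
def b : ATilde := .mk fun n => if n = 1 then 1 else 0

theorem mul_b (p : ATilde) : p * b = rightB p := by
  have : b = rightB 1 := by
    refine ext' fun n => ?_; rcases n with _ | n <;> simp [b, rightB, one_apply]
  rw [this, mul_rightB, mul_one]

theorem mul_a (p : ATilde) : p * a = rightA p := by
  have : a = rightA 1 := by
    refine ext' fun n => ?_; rcases n with _ | _ | n <;> simp [a, rightA, one_apply]
  rw [this, mul_rightA, mul_one]

/-- The defining commutation relation of `Ã`. -/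
theorem a_mul_b_sub : a * b - b * a = b ^ 2 := by
  rw [pow_two, mul_b, mul_b, mul_a]
  refine ext' fun n => ?_
  rcases n with _ | _ | _ | n <;> simp [rightA, rightB, a, b]

/-- The embedding of `ℂ[[b]]` in `Ã`, sending a series `S` to `S(b)`. -/
def ofB : PowerSeries ℂ →+* ATilde where
  toFun S := .mk fun n => Polynomial.C (PowerSeries.coeff n S)
  map_one' := by
    refine ext' fun n => ?_
    show Polynomial.C _ = _
    rw [PowerSeries.coeff_one, one_apply]
    split_ifs <;> simp
  map_zero' := by refine ext' fun n => ?_; simp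
  map_add' S T := by refine ext' fun n => ?_; simp
  map_mul' S T := by
    refine ext' fun n => ?_
    show Polynomial.C _ = _
    rw [PowerSeries.coeff_mul, mul_apply, map_sum]
    refine Finset.sum_congr rfl fun x _ => ?_
    rw [Finset.sum_eq_single (0, x.2)]
    · simp [bCoeff_zero_right]
    · rintro ⟨j, l⟩ hy hne
      have hj : 0 < j := by
        rcases Nat.eq_zero_or_pos j with rfl | h
        · simp_all
        · exact h
      simp [Polynomial.iterate_derivative_C hj]
    · simp

/-- `P` is homogeneous of degree `k` in `(a,b)` and monic in `a`:
`P = ∑ j ≤ k, c j a ^ j b ^ (k - j)` with `c k = 1`. -/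
def IsMonicHomogeneous (k : ℕ) (P : ATilde) : Prop :=
  ∃ c : ℕ → ℂ, c k = 1 ∧ P = ∑ j ∈ Finset.range (k + 1), c j • (a ^ j * b ^ (k - j))

/-- `R` is a polynomial in `a` of degree `< k`, with coefficients in `ℂ[[b]]`. -/
def DegreeLT (k : ℕ) (R : ATilde) : Prop := ∀ n, (R n).degree < k

/-- The valuation of `R` in `(a,b)` is at least `d`: only monomials `a ^ i b ^ n` with
`d ≤ i + n` occur in `R`. -/
def ValuationGE (d : ℕ) (R : ATilde) : Prop := ∀ n i, i + n < d → (R n).coeff i = 0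

end ATilde

namespace ABModule

open ATilde

universe u

/-- The `ℂ[[b]]`-module underlying an `Ã`-module. -/
@[reducible] def moduleB (E : Type u) [AddCommGroup E] [Module ATilde E] :
    Module (PowerSeries ℂ) E := Module.compHom E ofB

/-- An (a,b)-module: a left `Ã`-module that is free of finite type over `ℂ[[b]]`. -/
def IsABModule (E : Type u) [AddCommGroup E] [Module ATilde E] : Prop :=
  letI := moduleB E
  Module.Free (PowerSeries ℂ) E ∧ Module.Finite (PowerSeries ℂ) E

/-- The rank of an (a,b)-module: its rank over `ℂ[[b]]`. -/
def rank (E : Type u) [AddCommGroup E] [Module ATilde E] : ℕ :=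
  letI := moduleB E
  Module.finrank (PowerSeries ℂ) E

/-- A simple pole (a,b)-module: `a F ⊆ b F`. -/
def IsSimplePole (F : Type u) [AddCommGroup F] [Module ATilde F] : Prop :=
  IsABModule F ∧ ∀ x : F, ∃ y : F, a • x = b • y

/-- A regular (a,b)-module: an (a,b)-module which embeds in a simple pole (a,b)-module
(equivalently, its saturation by `b⁻¹ a` is of finite type over `ℂ[[b]]`). -/
def IsRegular (E : Type u) [AddCommGroup E] [Module ATilde E] : Prop :=
  IsABModule E ∧ ∃ (F : Type u) (_ : AddCommGroup F) (_ : Module ATilde F),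
    IsSimplePole F ∧ ∃ f : E →ₗ[ATilde] F, Function.Injective f

/-- `E` is monogenic: isomorphic to the quotient of `Ã` by a left ideal. -/
def IsMonogenic (E : Type u) [AddCommGroup E] [Module ATilde E] : Prop :=
  ∃ I : Submodule ATilde ATilde, Nonempty (E ≃ₗ[ATilde] (ATilde ⧸ I))

/-- `e` generates `E` over `Ã`, and its annihilator is the left ideal `Ã x`. -/
def IsGeneratorWithAnnihilator {E : Type u} [AddCommGroup E] [Module ATilde E]
    (e : E) (x : ATilde) : Prop :=
  (∀ y : E, ∃ u : ATilde, y = u • e) ∧ ∀ u : ATilde, u • e = 0 ↔ ∃ v : ATilde, u = v * x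

/-- `P` is the Bernstein element of `E`, a regular monogenic (a,b)-module of rank `k`: it is
homogeneous of degree `k` and monic in `a`, and `E ≃ Ã / Ã (P + b ^ 2 R)`, where `R` is a
polynomial in `a` of degree at most `k - 1` over `ℂ[[b]]` of valuation at least `k - 1`. -/
def IsBernsteinElement (E : Type u) [AddCommGroup E] [Module ATilde E] (P : ATilde) : Prop :=
  IsMonicHomogeneous (rank E) P ∧
    ∃ R : ATilde, DegreeLT (rank E) R ∧ ValuationGE (rank E - 1) R ∧
      ∃ e : E, IsGeneratorWithAnnihilator e (P + b ^ 2 * R)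

/-- The twisted action of a permutation:
`(λ_1, …, λ_k) ↦ (λ_{σ(1)} + σ(1) - 1, …, λ_{σ(k)} + σ(k) - k)`. -/
def twist {k : ℕ} (σ : Equiv.Perm (Fin k)) (lam : Fin k → ℂ) : Fin k → ℂ :=
  fun j => lam (σ j) + ((σ j : ℕ) : ℂ) - ((j : ℕ) : ℂ)

/-- The twisted orbit of `(λ_1, …, λ_k)`. -/
def twistedOrbit {k : ℕ} (lam : Fin k → ℂ) : Set (Fin k → ℂ) :=
  Set.range fun σ : Equiv.Perm (Fin k) => twist σ lam

/-- `Re μ_1 + 1 ≤ Re μ_2 + 2 ≤ ⋯ ≤ Re μ_k + k`. -/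
def IsOrdered {k : ℕ} (μ : Fin k → ℂ) : Prop :=
  ∀ i j : Fin k, i ≤ j → (μ i).re + ((i : ℕ) + 1) ≤ (μ j).re + ((j : ℕ) + 1)

/-- The product `(a - λ_1 b) (a - λ_2 b) ⋯ (a - λ_k b)`. -/
def linProd {k : ℕ} (lam : Fin k → ℂ) : ATilde :=
  (List.ofFn fun i : Fin k => a - lam i • b).prod

/-- The product `(a - μ_1 b) T_1⁻¹ (a - μ_2 b) T_2⁻¹ ⋯ (a - μ_{k-1} b) T_{k-1}⁻¹ (a - μ_k b)`. -/
def linProdWith {k : ℕ} (μ : Fin k → ℂ) (T : Fin (k - 1) → PowerSeries ℂ) : ATilde :=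
  (List.ofFn fun i : Fin k => (a - μ i • b) *
    (if h : (i : ℕ) < k - 1 then ofB (T ⟨i, h⟩)⁻¹ else 1)).prod

/-- The rank 2 (a,b)-module
`E_{λ,λ-n}(α) = Ã / Ã (a - (λ - n) b) (1 + α b ^ n)⁻¹ (a - (λ - 1) b)`. -/
abbrev ETwo (lam : ℂ) (n : ℕ) (α : ℂ) : Type :=
  ATilde ⧸ Submodule.span ATilde
    {(a - (lam - n) • b) * ofB (1 + PowerSeries.C α * PowerSeries.X ^ n)⁻¹ *
      (a - (lam - 1) • b)}

/-- A submodule `F` of `E` is normal when `F ∩ b E = b F` (in an (a,b)-module `E`: when `E / F`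
has no `b`-torsion). -/
def IsNormal {E : Type u} [AddCommGroup E] [Module ATilde E] (F : Submodule ATilde E) : Prop :=
  ∀ x : E, b • x ∈ F → x ∈ F

/-- `E` has a rank 2 subquotient `F / G`, with `G ⊆ F` normal in `E`, isomorphic to
`E_{λ,λ-n}(α)` for some `λ`, some `α ≠ 0` and some `n ≥ 1`. -/
def HasExceptionalSubquotient (E : Type u) [AddCommGroup E] [Module ATilde E] : Prop :=
  ∃ (lam α : ℂ) (n : ℕ) (G F : Submodule ATilde E), α ≠ 0 ∧ 1 ≤ n ∧ G ≤ F ∧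
    IsNormal G ∧ IsNormal F ∧ Nonempty ((F ⧸ G.submoduleOf F) ≃ₗ[ATilde] ETwo lam n α)

end ABModule

end

/-! Put `D = b⁻¹ a`, so that `D b = b (D + 1)`. An element `x = b ^ k f(D)`, with `f` of order at
most `k` over `ℂ[[b]]`, has a symbol `χ`, the reduction of `f` modulo `b`. For `(a - λ_1 b) ⋯ (a -
λ_k b)` it is `∏ (X - (λ_j + j - k))`, which depends only on the twisted orbit, and `b ^ 2 R` has
symbol `0`. So the given annihilator has the symbol attached to any member of the orbit
(`IsBernsteinElement.exists_hasSymbol`).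

Part 1 is Frobenius' method. Dividing `x u` on the right by `a - s b` leaves `b ^ k L u`, where `L`
is triangular on `ℂ[[b]]` with eigenvalues `χ(s + n)` (`HasSymbol.exists_division`). If `s` is a
root of `χ` and no `s + n` with `n ≥ 1` is one, then `L u = 0` has a solution with `u(0) = 1`, and
`a - s b` splits off on the right. The ordering of real parts makes the last exponent such a root,
and the quotient has the symbol of the remaining exponents (`HasSymbol.exists_eq_chain`).

Part 2 starts from an ordered tuple and exchanges neighbours. Exchanging the exponents in `(a - μ b)
U (a - ν b)` means solving `(b d/db + c) u = c U⁻¹` with `c = μ - 1 - ν` (`exists_swap`). The only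
obstruction is the coefficient `α` of `b ^ n` in `U⁻¹` when `n = -c ≥ 1`. If `α ≠ 0`, the
subquotient given by the two factors is `E_{ν+1,ν+1-n}(α)`, which is excluded
(`hasExceptionalSubquotient`). -/

namespace ATilde

/-! ### Commutation of `a` with power series in `b` -/

open Polynomial in
theorem a_mul_apply (q : ATilde) (n : ℕ) : (a * q) n = X * q n := by
  rw [mul_apply, Finset.sum_eq_single (0, n), Finset.sum_eq_single (0, n)]
  · simp [a, bCoeff_zero_left]
  · rintro ⟨i, j⟩ h hne
    have : i ≠ 0 := by rintro rfl; simp_all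
    simp [bCoeff_zero_left, this]
  · simp
  · rintro ⟨i, j⟩ h hne
    have : i ≠ 0 := by rintro rfl; simp_all
    simp [a, this]
  · simp

theorem ofB_apply (g : PowerSeries ℂ) (n : ℕ) :
    ofB g n = Polynomial.C (PowerSeries.coeff n g) := rfl

theorem mul_apply_zero (p q : ATilde) : (p * q) 0 = p 0 * q 0 := by
  simp [mul_apply, bCoeff_zero_right]

theorem b_eq_ofB : b = ofB PowerSeries.X := by
  refine ext' fun n => ?_
  rw [ofB_apply, PowerSeries.coeff_X]
  show (if n = 1 then (1 : Polynomial ℂ) else 0) = _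
  split_ifs <;> simp

theorem smul_eq_ofB_mul (s : ℂ) (x : ATilde) : s • x = ofB (PowerSeries.C s) * x := by
  have h : ofB (PowerSeries.C s) = s • 1 := by
    refine ext' fun n => ?_
    rw [ofB_apply, PowerSeries.coeff_C, smul_apply, one_apply]
    split_ifs <;> simp [Polynomial.smul_eq_C_mul]
  rw [h, smul_mul_assoc, one_mul]

theorem smul_b (s : ℂ) : s • b = ofB (PowerSeries.C s * PowerSeries.X) := by
  rw [smul_eq_ofB_mul, b_eq_ofB, map_mul]

/-- The derivation `X d/dX` of the power series ring. -/
noncomputable def euler : PowerSeries ℂ →ₗ[ℂ] PowerSeries ℂ where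
  toFun g := PowerSeries.mk fun n => n * PowerSeries.coeff n g
  map_add' f g := by ext n; simp [mul_add]
  map_smul' c g := by ext n; simp [mul_left_comm]

@[simp] theorem coeff_euler (g : PowerSeries ℂ) (n : ℕ) :
    PowerSeries.coeff n (euler g) = n * PowerSeries.coeff n g := by
  simp [euler]

/-- From `[a, b] = b ^ 2` one gets `[a, g] = b ^ 2 g'(b)`, which is `b` times the Euler derivative
of `g`. -/
theorem a_mul_ofB (g : PowerSeries ℂ) :
    a * ofB g = ofB g * a + ofB (PowerSeries.X * euler g) := by
  refine ext' fun n => ?_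
  rw [a_mul_apply, add_apply, mul_a, rightA_apply, ofB_apply, ofB_apply]
  rcases n with _ | n
  · rw [PowerSeries.coeff_zero_X_mul, shift_zero, map_zero, add_zero, sub_zero]
  · rw [PowerSeries.coeff_succ_X_mul, coeff_euler, shift_succ, ofB_apply,
      Polynomial.smul_eq_C_mul, map_mul]
    ring

theorem sub_mul_ofB (s r : ℂ) (g : PowerSeries ℂ) :
    (a - s • b) * ofB g = ofB g * (a - r • b)
      + ofB (PowerSeries.X * (euler g + PowerSeries.C (r - s) * g)) := by
  rw [sub_mul, a_mul_ofB, mul_sub, smul_b, smul_b, ← map_mul, ← map_mul]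
  have : PowerSeries.X * (euler g + PowerSeries.C (r - s) * g)
      = PowerSeries.X * euler g + g * (PowerSeries.C r * PowerSeries.X)
        - PowerSeries.C s * PowerSeries.X * g := by
    rw [map_sub]; ring
  rw [this, map_sub, map_add]
  abel

theorem euler_mul (f g : PowerSeries ℂ) : euler (f * g) = euler f * g + f * euler g := by
  ext n
  simp only [coeff_euler, map_add, PowerSeries.coeff_mul, ← Finset.sum_add_distrib,
    Finset.mul_sum]
  refine Finset.sum_congr rfl fun x hx => ?_
  rw [← Finset.HasAntidiagonal.mem_antidiagonal.mp hx]
  push_cast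
  ring

theorem euler_X_pow (k : ℕ) :
    euler (PowerSeries.X ^ k) = PowerSeries.C (k : ℂ) * PowerSeries.X ^ k := by
  ext n
  rw [coeff_euler, PowerSeries.coeff_C_mul, PowerSeries.coeff_X_pow]
  split_ifs with h <;> simp [h]

/-! ### Symbols and right division -/

/-- `HasSymbol k χ x`: writing `D = b⁻¹ a`, the element `x` is `b ^ k` times a differential
operator of order at most `k` in `D` over `ℂ[[b]]`, whose reduction modulo `b` is `χ(D)`. -/
inductive HasSymbol : ℕ → Polynomial ℂ → ATilde → Prop
  | ofB (g : PowerSeries ℂ) :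
      HasSymbol 0 (Polynomial.C (PowerSeries.constantCoeff g)) (ofB g)
  | add {k χ ψ x y} : HasSymbol k χ x → HasSymbol k ψ y → HasSymbol k (χ + ψ) (x + y)
  | ofB_mul {k χ x} (g : PowerSeries ℂ) : HasSymbol k χ x →
      HasSymbol k (Polynomial.C (PowerSeries.constantCoeff g) * χ) (ATilde.ofB g * x)
  | b_mul {k χ x} : HasSymbol k χ x → HasSymbol (k + 1) χ (b * x)
  | a_mul {k χ x} : HasSymbol k χ x →
      HasSymbol (k + 1) (χ * (Polynomial.X + Polynomial.C (k : ℂ))) (a * x)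

namespace HasSymbol

open Polynomial

theorem congr {k χ ψ x y} (h : HasSymbol k χ x) (hχ : χ = ψ) (hx : x = y) : HasSymbol k ψ y :=
  hχ ▸ hx ▸ h

theorem X_pow_mul (k : ℕ) (g : PowerSeries ℂ) :
    HasSymbol k (C (PowerSeries.constantCoeff g)) (ATilde.ofB (PowerSeries.X ^ k * g)) := by
  induction k with
  | zero => exact (HasSymbol.ofB g).congr rfl (by simp)
  | succ k ih => exact ih.b_mul.congr rfl (by rw [b_eq_ofB, ← map_mul]; ring_nf)

theorem zero (k : ℕ) : HasSymbol k 0 0 := (X_pow_mul k 0).congr (by simp) (by simp)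

theorem sum {ι : Type*} (s : Finset ι) {k : ℕ} {χ : ι → ℂ[X]} {x : ι → ATilde}
    (h : ∀ i ∈ s, HasSymbol k (χ i) (x i)) : HasSymbol k (∑ i ∈ s, χ i) (∑ i ∈ s, x i) := by
  classical
  induction s using Finset.induction_on with
  | empty => simpa using zero k
  | insert i s hi ih =>
    rw [Finset.sum_insert hi, Finset.sum_insert hi]
    exact (h i (by simp)).add (ih fun j hj => h j (by simp [hj]))

theorem of_zero {k χ x} (h : HasSymbol k χ x) (hk : k = 0) :
    ∃ g : PowerSeries ℂ, x = ATilde.ofB g ∧ χ = C (PowerSeries.constantCoeff g) := by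
  induction h with
  | ofB g => exact ⟨g, rfl, rfl⟩
  | add _ _ h1 h2 =>
    obtain ⟨f, rfl, rfl⟩ := h1 hk
    obtain ⟨g, rfl, rfl⟩ := h2 hk
    exact ⟨f + g, by simp, by simp⟩
  | ofB_mul g _ h =>
    obtain ⟨f, rfl, rfl⟩ := h hk
    exact ⟨g * f, by simp, by simp⟩
  | b_mul => omega
  | a_mul => omega

/-- `a - s b = b (D - s)`, and moving this `b` to the left across `f(D)` replaces `D` by `D + 1`. -/
theorem mul_sub {k χ x} (h : HasSymbol k χ x) (s : ℂ) :
    HasSymbol (k + 1) (χ.comp (X + 1) * (X - C s)) (x * (a - s • b)) := by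
  induction h with
  | ofB g =>
    have h1 := (HasSymbol.ofB g).a_mul.add
      (HasSymbol.ofB (-euler g - PowerSeries.C s * g)).b_mul
    refine h1.congr ?_ ?_
    · have : PowerSeries.constantCoeff (euler g) = 0 := by
        rw [← PowerSeries.coeff_zero_eq_constantCoeff_apply, coeff_euler]; simp
      simp [this]; ring
    · rw [a_mul_ofB, _root_.mul_sub, smul_b, b_eq_ofB, ← map_mul, ← map_mul, add_assoc, ← map_add]
      have : PowerSeries.X * euler g + PowerSeries.X * (-euler g - PowerSeries.C s * g)
          = -(g * (PowerSeries.C s * PowerSeries.X)) := by ring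
      rw [this, map_neg, ← sub_eq_add_neg]
  | add _ _ h1 h2 => exact (h1.add h2).congr (by simp; ring) (by rw [add_mul])
  | ofB_mul g _ h => exact (h.ofB_mul g).congr (by simp; ring) (by rw [mul_assoc])
  | b_mul _ h => exact h.b_mul.congr rfl (by rw [mul_assoc])
  | a_mul _ h => exact h.a_mul.congr (by simp; ring) (by rw [mul_assoc])

/-- A linear operator on power series that preserves the `X`-adic filtration, with eigenvalue
`e n` on the graded piece of degree `n`. -/
def _root_.ATilde.IsTriangular (L : PowerSeries ℂ →ₗ[ℂ] PowerSeries ℂ) (e : ℕ → ℂ) : Prop :=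
  ∀ n u, (∀ i < n, PowerSeries.coeff i u = 0) →
    (∀ i < n, PowerSeries.coeff i (L u) = 0) ∧
      PowerSeries.coeff n (L u) = e n * PowerSeries.coeff n u

theorem _root_.ATilde.coeff_mul_of_coeff_lt {n : ℕ} {u : PowerSeries ℂ}
    (hu : ∀ i < n, PowerSeries.coeff i u = 0) (g : PowerSeries ℂ) :
    (∀ i < n, PowerSeries.coeff i (g * u) = 0) ∧
      PowerSeries.coeff n (g * u) = PowerSeries.constantCoeff g * PowerSeries.coeff n u := by
  constructor
  · intro i hi
    rw [PowerSeries.coeff_mul]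
    refine Finset.sum_eq_zero fun x hx => ?_
    have := Finset.HasAntidiagonal.mem_antidiagonal.mp hx
    rw [hu _ (by omega), mul_zero]
  · rw [PowerSeries.coeff_mul, Finset.sum_eq_single (0, n)]
    · simp
    · rintro ⟨i, j⟩ hx hne
      have := Finset.HasAntidiagonal.mem_antidiagonal.mp hx
      rw [hu, mul_zero]
      rcases Nat.lt_or_ge j n with h | h
      · exact h
      · exact absurd (Prod.ext (show i = 0 by simp at this; omega)
          (show j = n by simp at this; omega)) hne
    · simp

/-- Right division of `x u` by `a - s b`. -/
theorem exists_division {k χ x} (h : HasSymbol k χ x) (s : ℂ) :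
    ∃ L : PowerSeries ℂ →ₗ[ℂ] PowerSeries ℂ, IsTriangular L (fun n => χ.eval (s + n)) ∧
      -- The quotient has level `k - 1`, so level `0` is kept apart by forcing `Y = 0`. The
      -- polynomial identity is the same division on symbols; it determines the symbol of `Y`.
      ∀ u, ∃ Y η, (k = 0 → Y = 0 ∧ η = 0) ∧ (∀ j, k = j + 1 → HasSymbol j η Y) ∧
        C (PowerSeries.constantCoeff u) * χ
          = η.comp (X + 1) * (X - C s) + C (PowerSeries.constantCoeff (L u)) ∧
        x * ATilde.ofB u = Y * (a - s • b) + ATilde.ofB (PowerSeries.X ^ k * L u) := by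
  induction h with
  | ofB g =>
    refine ⟨LinearMap.mulLeft ℂ g, fun n u hu => ?_, fun u => ?_⟩
    · simpa using coeff_mul_of_coeff_lt hu g
    · exact ⟨0, 0, by simp, by simp, by simp; ring, by simp⟩
  | add _ _ h1 h2 =>
    obtain ⟨L, hL, hY⟩ := h1
    obtain ⟨L', hL', hY'⟩ := h2
    refine ⟨L + L', fun n u hu => ?_, fun u => ?_⟩
    · refine ⟨fun i hi => ?_, ?_⟩
      · simp [(hL n u hu).1 i hi, (hL' n u hu).1 i hi]
      · simp [(hL n u hu).2, (hL' n u hu).2]; ring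
    · obtain ⟨Y, η, a0, a1, a2, a3⟩ := hY u
      obtain ⟨Y', η', b0, b1, b2, b3⟩ := hY' u
      refine ⟨Y + Y', η + η', fun hk => ?_, fun j hj => (a1 j hj).add (b1 j hj), ?_, ?_⟩
      · simp [a0 hk, b0 hk]
      · simp only [LinearMap.add_apply, map_add, add_comp]
        linear_combination a2 + b2
      · rw [add_mul, a3, b3, LinearMap.add_apply, mul_add, map_add, add_mul]; abel
  | ofB_mul g _ h =>
    obtain ⟨L, hL, hY⟩ := h
    refine ⟨LinearMap.mulLeft ℂ g ∘ₗ L, fun n u hu => ?_, fun u => ?_⟩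
    · have := coeff_mul_of_coeff_lt (hL n u hu).1 g
      refine ⟨this.1, ?_⟩
      simp only [LinearMap.comp_apply, LinearMap.mulLeft_apply]
      rw [this.2, (hL n u hu).2]; simp; ring
    · obtain ⟨Y, η, a0, a1, a2, a3⟩ := hY u
      refine ⟨ATilde.ofB g * Y, C (PowerSeries.constantCoeff g) * η, fun hk => ?_,
        fun j hj => (a1 j hj).ofB_mul g, ?_, ?_⟩
      · simp [a0 hk]
      · simp only [LinearMap.comp_apply, LinearMap.mulLeft_apply, map_mul, mul_comp, C_comp]
        linear_combination C (PowerSeries.constantCoeff g) * a2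
      · rw [mul_assoc, a3, mul_add, mul_assoc, ← map_mul]
        simp only [LinearMap.comp_apply, LinearMap.mulLeft_apply]
        congr 2
        ring
  | b_mul _ h =>
    obtain ⟨L, hL, hY⟩ := h
    refine ⟨L, hL, fun u => ?_⟩
    obtain ⟨Y, η, a0, a1, a2, a3⟩ := hY u
    refine ⟨b * Y, η, by simp, fun j hj => ?_, a2, ?_⟩
    · obtain rfl : _ = j := Nat.succ_injective hj
      rename_i k _ _ _
      rcases k with _ | k
      · rw [(a0 rfl).1, (a0 rfl).2, mul_zero]; exact zero 0
      · exact (a1 k rfl).b_mul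
    · rw [mul_assoc, a3, mul_add, mul_assoc, b_eq_ofB, ← map_mul]
      congr 2
      ring
  | @a_mul k _ _ _ h =>
    obtain ⟨L, hL, hY⟩ := h
    -- Modulo left multiples of `a - s b`, the product `a b ^ k g` is `b ^ (k + 1) (euler g + (s +
    -- k) g)`.
    refine ⟨euler ∘ₗ L + (s + k) • L, fun n u hu => ?_, fun u => ?_⟩
    · refine ⟨fun i hi => ?_, ?_⟩
      · simp [(hL n u hu).1 i hi]
      · simp [(hL n u hu).2]; ring
    · obtain ⟨Y, η, a0, a1, a2, a3⟩ := hY u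
      have h0 : PowerSeries.constantCoeff (euler (L u)) = 0 := by
        rw [← PowerSeries.coeff_zero_eq_constantCoeff_apply, coeff_euler]; simp
      -- The shift `k - 1` is the level of `Y`; for `k = 0` it is harmless because `η = 0`.
      refine ⟨a * Y + ATilde.ofB (PowerSeries.X ^ k * L u),
        η * (X + C ((k : ℂ) - 1)) + C (PowerSeries.constantCoeff (L u)), by simp,
        fun j hj => ?_, ?_, ?_⟩
      · obtain rfl : _ = j := Nat.succ_injective hj
        refine HasSymbol.add ?_ (X_pow_mul k _)
        rcases k with _ | k
        · rw [(a0 rfl).1, (a0 rfl).2, mul_zero, zero_mul]; exact zero 0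
        · exact (a1 k rfl).a_mul.congr (by simp) rfl
      · have : PowerSeries.constantCoeff ((euler ∘ₗ L + (s + k) • L) u)
            = (s + k) * PowerSeries.constantCoeff (L u) := by
          simp [h0]
        rw [this]
        simp only [add_comp, mul_comp, X_comp, C_comp, sub_comp, one_comp,
            map_add, map_mul, map_sub, map_one]
        linear_combination (X + C (k : ℂ)) * a2
      · rw [mul_assoc, a3, mul_add, add_mul, ← mul_assoc, a_mul_ofB,
          _root_.mul_sub (ATilde.ofB _), smul_b, ← map_mul, euler_mul, euler_X_pow]
        have : PowerSeries.X ^ (k + 1) * ((euler ∘ₗ L + (s + k) • L) u)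
            = PowerSeries.X * (PowerSeries.C (k : ℂ) * PowerSeries.X ^ k * L u
                + PowerSeries.X ^ k * euler (L u))
              + PowerSeries.X ^ k * L u * (PowerSeries.C s * PowerSeries.X) := by
          simp only [LinearMap.add_apply, LinearMap.comp_apply, LinearMap.smul_apply,
            PowerSeries.smul_eq_C_mul, map_add]
          ring
        rw [this, map_add]
        abel

end HasSymbol

/-! ### Frobenius' method -/

/-- The sequence defined by a recursion on all previous terms. -/
noncomputable def recSeq (F : ∀ n : ℕ, (Fin n → ℂ) → ℂ) : ℕ → ℂ
  | n => F n fun i => recSeq F i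
decreasing_by exact i.2

/-- In degree `n`, `L u = 0` reads `e n * u_n` plus a term in the earlier coefficients, so `u` is
built recursively from `u_0 = 1`. Degree `0` imposes nothing since `e 0 = 0`. -/
theorem IsTriangular.exists_kernel {L : PowerSeries ℂ →ₗ[ℂ] PowerSeries ℂ} {e : ℕ → ℂ}
    (hL : IsTriangular L e) (h0 : e 0 = 0) (he : ∀ n, n ≠ 0 → e n ≠ 0) :
    ∃ u, PowerSeries.constantCoeff u = 1 ∧ L u = 0 := by
  let F : ∀ n : ℕ, (Fin n → ℂ) → ℂ := fun n v => if n = 0 then 1 else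
    -(e n)⁻¹ * PowerSeries.coeff n
      (L (PowerSeries.mk fun i => if h : i < n then v ⟨i, h⟩ else 0))
  let u : PowerSeries ℂ := PowerSeries.mk (recSeq F)
  have hu : ∀ n, PowerSeries.coeff n u = F n fun i => PowerSeries.coeff i u := by
    intro n
    simp only [u, PowerSeries.coeff_mk]
    conv_lhs => rw [recSeq]
  refine ⟨u, ?_, ?_⟩
  · rw [← PowerSeries.coeff_zero_eq_constantCoeff_apply, hu]; simp [F]
  · ext n
    let t : PowerSeries ℂ := PowerSeries.mk fun i => if i < n then PowerSeries.coeff i u else 0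
    have ht : ∀ i < n, PowerSeries.coeff i (u - t) = 0 := by
      intro i hi; simp [t, hi]
    have h1 := (hL n (u - t) ht).2
    have h2 : PowerSeries.coeff n t = 0 := by simp [t]
    rw [map_sub, map_sub, map_sub, h2, sub_zero] at h1
    rw [map_zero]
    rcases eq_or_ne n 0 with rfl | hn
    · have : t = 0 := by ext i; simp [t]
      simpa [h0, this] using h1
    · have h3 : PowerSeries.coeff n u = -(e n)⁻¹ * PowerSeries.coeff n (L t) := by
        rw [hu]; simp [F, hn, t]
      rw [h3] at h1
      field_simp [he n hn] at h1
      have h4 := he n hn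
      linear_combination h1

theorem HasSymbol.exists_right_factor {k : ℕ} {χ : Polynomial ℂ} {x : ATilde}
    (h : HasSymbol (k + 1) χ x) {s : ℂ} (hs : χ.eval s = 0)
    (hn : ∀ n : ℕ, n ≠ 0 → χ.eval (s + n) ≠ 0) :
    ∃ u Y η, PowerSeries.constantCoeff u = 1 ∧ HasSymbol k η Y ∧
      χ = η.comp (Polynomial.X + 1) * (Polynomial.X - Polynomial.C s) ∧
      x * ATilde.ofB u = Y * (a - s • b) := by
  obtain ⟨L, hL, hY⟩ := h.exists_division s
  obtain ⟨u, hu, hLu⟩ := hL.exists_kernel (by simpa using hs) hn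
  obtain ⟨Y, η, -, h1, h2, h3⟩ := hY u
  exact ⟨u, Y, η, hu, h1 k rfl, by simpa [hu, hLu] using h2, by simpa [hLu] using h3⟩

end ATilde

/-! ### Factorisation into factors of degree one -/

namespace ATilde

open Polynomial

theorem HasSymbol.eq_ofB {x : ATilde} {χ : ℂ[X]} (h : HasSymbol 0 χ x) :
    ∃ g : PowerSeries ℂ, x = ATilde.ofB g ∧ χ = C (PowerSeries.constantCoeff g) := h.of_zero rfl

theorem ofB_mul_ofB_inv {u : PowerSeries ℂ} (hu : PowerSeries.constantCoeff u = 1) :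
    ofB u * ofB u⁻¹ = 1 := by
  rw [← map_mul, PowerSeries.mul_inv_cancel _ (by simp [hu]), map_one]

theorem ofB_inv_mul_ofB {u : PowerSeries ℂ} (hu : PowerSeries.constantCoeff u = 1) :
    ofB u⁻¹ * ofB u = 1 := by
  rw [← map_mul, PowerSeries.inv_mul_cancel _ (by simp [hu]), map_one]

/-- The product `(a - μ₀ b) U₀ (a - μ₁ b) U₁ ⋯ (a - μₖ₋₁ b) Uₖ₋₁`. -/
noncomputable def chain (μ : ℕ → ℂ) (U : ℕ → PowerSeries ℂ) (k : ℕ) : ATilde :=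
  ((List.range k).map fun i => (a - μ i • b) * ofB (U i)).prod

theorem chain_zero (μ : ℕ → ℂ) (U : ℕ → PowerSeries ℂ) : chain μ U 0 = 1 := rfl

theorem chain_succ (μ : ℕ → ℂ) (U : ℕ → PowerSeries ℂ) (k : ℕ) :
    chain μ U (k + 1) = chain μ U k * ((a - μ k • b) * ofB (U k)) :=
  List.prod_range_succ _ _

theorem chain_add (μ : ℕ → ℂ) (U : ℕ → PowerSeries ℂ) (k l : ℕ) :
    chain μ U (k + l) = chain μ U k * chain (fun i => μ (k + i)) (fun i => U (k + i)) l := by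
  induction l with
  | zero => rw [chain_zero, mul_one, add_zero]
  | succ l ih => rw [← add_assoc, chain_succ, ih, chain_succ, mul_assoc]

theorem chain_congr {μ μ' : ℕ → ℂ} {U U' : ℕ → PowerSeries ℂ} {k : ℕ}
    (hμ : ∀ i < k, μ i = μ' i) (hU : ∀ i < k, U i = U' i) : chain μ U k = chain μ' U' k := by
  unfold chain
  congr 1
  refine List.map_congr_left fun i hi => ?_
  rw [hμ i (List.mem_range.mp hi), hU i (List.mem_range.mp hi)]

/-- The symbol of a product `(a - μ₀ b) ⋯ (a - μₖ₋₁ b)`. -/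
noncomputable def chainSymbol (μ : ℕ → ℂ) (k : ℕ) : ℂ[X] :=
  -- The factor of index `i` has `k - 1 - i` factors on its right, each of which lowers its root by
  -- `1`.
  ∏ i ∈ Finset.range k, (X - C (μ i + i + 1 - k))

theorem chainSymbol_succ (μ : ℕ → ℂ) (k : ℕ) :
    chainSymbol μ (k + 1) = (chainSymbol μ k).comp (X + 1) * (X - C (μ k)) := by
  rw [chainSymbol, Finset.prod_range_succ, chainSymbol, Polynomial.prod_comp]
  congr 1
  · refine Finset.prod_congr rfl fun i _ => ?_
    simp only [Nat.cast_add, Nat.cast_one, map_sub, map_add, map_one, sub_comp, X_comp, add_comp,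
      C_comp, one_comp]
    ring
  · congr 2
    push_cast
    ring

theorem hasSymbol_chain (μ : ℕ → ℂ) (k : ℕ) : HasSymbol k (chainSymbol μ k) (chain μ 1 k) := by
  induction k with
  | zero => exact (HasSymbol.ofB 1).congr (by simp [chainSymbol]) (by simp [chain_zero])
  | succ k ih =>
    rw [chainSymbol_succ, chain_succ]
    simpa using ih.mul_sub (μ k)

theorem comp_X_add_one_injective {p q : ℂ[X]} (h : p.comp (X + 1) = q.comp (X + 1)) : p = q := by
  have := congrArg (fun r : ℂ[X] => r.comp (X - 1)) h
  simpa [comp_assoc] using this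

/-- Factorisation of an operator whose exponents have nondecreasing real parts. -/
theorem HasSymbol.exists_eq_chain {k : ℕ} {μ : ℕ → ℂ} {x : ATilde}
    (hμ : ∀ i j, i ≤ j → j < k → (μ i).re + i ≤ (μ j).re + j)
    (h : HasSymbol k (chainSymbol μ k) x) :
    ∃ (U : ℕ → PowerSeries ℂ) (v : PowerSeries ℂ), (∀ i, PowerSeries.constantCoeff (U i) = 1) ∧
      PowerSeries.constantCoeff v = 1 ∧ x = ATilde.ofB v * chain μ U k := by
  induction k generalizing x with
  | zero =>
    obtain ⟨g, rfl, hg⟩ := h.eq_ofB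
    refine ⟨1, g, by simp, ?_, by simp [chain_zero]⟩
    have : (C 1 : ℂ[X]) = C (PowerSeries.constantCoeff g) := by
      rw [← hg]; simp [chainSymbol]
    exact (C_injective this).symm
  | succ k ih =>
    have hs : (chainSymbol μ (k + 1)).eval (μ k) = 0 := by simp [chainSymbol_succ]
    have hn : ∀ n : ℕ, n ≠ 0 → (chainSymbol μ (k + 1)).eval (μ k + n) ≠ 0 := by
      intro n hn
      rw [chainSymbol, eval_prod]
      refine Finset.prod_ne_zero_iff.mpr fun i hi h0 => ?_
      -- If `μ k + n` were the root of index `i`, then `Re μ_k + k + n = Re μ_i + i`, against the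
      -- ordering.
      have h1 := hμ i k (by simp at hi; omega) (by omega)
      have h2 := congrArg Complex.re h0
      have h3 : (1 : ℝ) ≤ n := by exact_mod_cast Nat.one_le_iff_ne_zero.mpr hn
      simp at h2
      linarith
    obtain ⟨u, Y, η, hu, hY, hη, hx⟩ := h.exists_right_factor hs hn
    rw [chainSymbol_succ] at hη
    have := comp_X_add_one_injective (mul_right_cancel₀ (X_sub_C_ne_zero (μ k)) hη)
    subst this
    obtain ⟨U, v, hU, hv, rfl⟩ := ih (fun i j hij hj => hμ i j hij (by omega)) hY
    refine ⟨Function.update U k u⁻¹, v, fun i => ?_, hv, ?_⟩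
    · rcases eq_or_ne i k with rfl | hi
      · simp [hu]
      · simp [hi, hU]
    · rw [chain_succ, Function.update_self,
        chain_congr (μ' := μ) (U' := U) (fun _ _ => rfl)
          (fun i hi => Function.update_of_ne hi.ne _ _),
        ← mul_assoc, ← mul_assoc, ← hx, mul_assoc, ofB_mul_ofB_inv hu, mul_one]

/-! ### Exchange of two neighbouring exponents -/

theorem euler_C_mul_X (c : ℂ) :
    euler (PowerSeries.C c * PowerSeries.X) = PowerSeries.C c * PowerSeries.X := by
  have h := euler_X_pow 1
  rw [← PowerSeries.smul_eq_C_mul, map_smul]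
  simp only [pow_one, Nat.cast_one, map_one, one_mul] at h
  rw [h]

/-- Exchange of the exponents of two consecutive factors, when there is no obstruction. -/
theorem exists_swap {μ ν : ℂ} {U : PowerSeries ℂ} (hU : PowerSeries.constantCoeff U = 1)
    (hn : ∀ n : ℕ, 1 ≤ n → ν + 1 - μ = n → PowerSeries.coeff n U⁻¹ = 0) :
    ∃ v w z : PowerSeries ℂ, PowerSeries.constantCoeff v = 1 ∧ PowerSeries.constantCoeff w = 1 ∧
      PowerSeries.constantCoeff z = 1 ∧ (a - μ • b) * ofB U * (a - ν • b)
        = ofB v * ((a - (ν + 1) • b) * ofB w) * ((a - (μ - 1) • b) * ofB z) := by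
  set c : ℂ := μ - 1 - ν with hc
  -- The solution of `(euler + c) u = c U⁻¹` with `u_0 = 1`. In the resonant degree `m = -c ≥ 1`
  -- division by zero gives the coefficient `0`, and `hn` makes the right-hand side vanish there.
  set u : PowerSeries ℂ := PowerSeries.mk fun m => if m = 0 then 1 else
    c * PowerSeries.coeff m U⁻¹ / (m + c) with hu
  have hu0 : PowerSeries.constantCoeff u = 1 := by
    rw [← PowerSeries.coeff_zero_eq_constantCoeff_apply]; simp [hu]
  have hsol : euler u + PowerSeries.C c * u = PowerSeries.C c * U⁻¹ := by
    ext m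
    rw [map_add, coeff_euler, PowerSeries.coeff_C_mul, PowerSeries.coeff_C_mul, ← add_mul, hu,
      PowerSeries.coeff_mk]
    split_ifs with hm
    · subst hm; simp [hU]
    · by_cases hmc : (m : ℂ) + c = 0
      · rw [hmc, zero_mul, hn m (by omega) (by linear_combination -hmc), mul_zero]
      · field_simp
  set Y : ATilde := (a - μ • b) * ofB (U * u) + ofB (PowerSeries.C c * PowerSeries.X) with hY
  have h1 : (a - μ • b) * ofB U * (a - ν • b) * ofB u = Y * (a - (μ - 1) • b) := by
    have hX : U * (PowerSeries.X * (PowerSeries.C c * U⁻¹)) = PowerSeries.C c * PowerSeries.X := by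
      have : U * U⁻¹ = 1 := PowerSeries.mul_inv_cancel _ (by simp [hU])
      linear_combination PowerSeries.C c * PowerSeries.X * this
    -- This says `(a - μ b) c b = c b (a - (μ - 1) b)`: the remainder left by `u` is itself a left
    -- multiple of `a - (μ - 1) b`.
    have hz : euler (PowerSeries.C c * PowerSeries.X)
        + PowerSeries.C (μ - 1 - μ) * (PowerSeries.C c * PowerSeries.X) = 0 := by
      rw [euler_C_mul_X, show μ - 1 - μ = -1 by ring, map_neg, map_one]; ring
    rw [mul_assoc, sub_mul_ofB ν (μ - 1), ← hc, hsol, mul_assoc, mul_add, ← mul_assoc (ofB U),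
      ← map_mul, ← map_mul, hX, mul_add, sub_mul_ofB μ (μ - 1) (PowerSeries.C c * PowerSeries.X), hz,
      mul_zero, map_zero, add_zero, hY, add_mul, mul_assoc]
  -- The left quotient has root `μ - c = ν + 1`, so the one-factor case of the factorisation applies
  -- to it.
  have h2 : HasSymbol 1 (chainSymbol (fun _ => ν + 1) 1) Y := by
    have h3 := ((HasSymbol.ofB 1).mul_sub μ).ofB_mul (U * u)
    refine (h3.add (HasSymbol.X_pow_mul 1 (euler (U * u) + PowerSeries.C c))).congr ?_ ?_
    · have : PowerSeries.constantCoeff (euler (U * u)) = 0 := by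
        rw [← PowerSeries.coeff_zero_eq_constantCoeff_apply, coeff_euler]; simp
      simp only [map_add, map_mul, this, hU, hu0, PowerSeries.constantCoeff_C, hc, chainSymbol,
        Finset.prod_range_one]
      simp
      ring
    · rw [hY, sub_mul_ofB μ μ, map_one, one_mul, sub_self, map_zero, zero_mul, add_zero, add_assoc,
        ← map_add]
      congr 2
      ring
  obtain ⟨W, v, hW, hv, hYv⟩ := h2.exists_eq_chain fun i j hij hj => by
    obtain rfl : i = j := by omega
    exact le_rfl
  refine ⟨v, W 0, u⁻¹, hv, hW 0, by simp [hu0], ?_⟩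
  rw [← mul_one ((a - μ • b) * ofB U * (a - ν • b)), ← ofB_mul_ofB_inv hu0, ← mul_assoc, h1, hYv,
    chain_succ, chain_zero, one_mul]
  simp only [mul_assoc]

end ATilde

/-! ### Reduction modulo `b` and cancellation -/

namespace ATilde

theorem bCoeff_one (j : ℕ) : bCoeff 1 j = (-1) ^ j := by simp [bCoeff]

theorem b_mul_apply_succ (q : ATilde) (n : ℕ) : (b * q) (n + 1) =
    ∑ y ∈ Finset.HasAntidiagonal.antidiagonal n,
      (-1 : ℂ) ^ y.1 • Polynomial.derivative^[y.1] (q y.2) := by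
  rw [mul_apply, Finset.sum_eq_single (1, n)]
  · simp [b, bCoeff_one]
  · rintro ⟨i, j⟩ h hne
    have : i ≠ 1 := by
      rintro rfl
      have := Finset.HasAntidiagonal.mem_antidiagonal.mp h
      exact hne (Prod.ext rfl (by simp at this ⊢; omega))
    simp [b, this]
  · intro h
    exact absurd (Finset.HasAntidiagonal.mem_antidiagonal.mpr (by simp; omega)) h

theorem b_mul_apply_zero (q : ATilde) : (b * q) 0 = 0 := by
  rw [mul_apply_zero]; simp [b]

/-- Moving `b` across `q` applies `∑ (-1) ^ j ∂ ^ j b ^ j`, with `∂` the derivative in `a`; this is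
the inverse of `1 + ∂ b`, which therefore recovers `q` from `b q`. -/
theorem b_mul_apply_rec (q : ATilde) (n : ℕ) :
    q n = (b * q) (n + 1) + Polynomial.derivative ((b * q) n) := by
  rcases n with _ | n
  · simp [b_mul_apply_succ, b_mul_apply_zero]
  · rw [b_mul_apply_succ, b_mul_apply_succ, Finset.Nat.sum_antidiagonal_succ, map_sum, add_assoc,
      ← Finset.sum_add_distrib, Finset.sum_eq_zero, add_zero]
    · simp
    · intro y _
      simp [pow_succ, Function.iterate_succ_apply']

theorem exists_eq_b_mul {z : ATilde} (hz : z 0 = 0) : ∃ q, z = b * q := by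
  let q : ATilde := .mk fun n => z (n + 1) + Polynomial.derivative (z n)
  refine ⟨q, ext' fun n => ?_⟩
  induction n with
  | zero => rw [hz, b_mul_apply_zero]
  | succ n ih =>
    have h1 := b_mul_apply_rec q n
    rw [← ih] at h1
    exact add_right_cancel (show z (n + 1) + Polynomial.derivative (z n) = _ from h1)

theorem b_mul_left_cancel {p q : ATilde} (h : b * p = b * q) : p = q :=
  ext' fun n => by rw [b_mul_apply_rec p, b_mul_apply_rec q, h]

/-- The lowest nonzero coefficient of `y` is multiplied by `x 0` in the domain `ℂ[a]`. -/
theorem eq_zero_of_mul_eq_zero {y x : ATilde} (hx : x 0 ≠ 0) (h : y * x = 0) : y = 0 := by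
  refine ext' fun n => ?_
  induction n using Nat.strong_induction_on with
  | _ n ih =>
    have h1 : (y * x) n = y n * x 0 := by
      rw [mul_apply, Finset.sum_eq_single (n, 0)]
      · simp [bCoeff_zero_right]
      · rintro ⟨i, j⟩ hij hne
        have h2 := Finset.HasAntidiagonal.mem_antidiagonal.mp hij
        have h3 : i < n := by
          rcases Nat.lt_or_ge i n with h | h
          · exact h
          · exact absurd (Prod.ext (show i = n by simp at h2; omega)
              (show j = 0 by simp at h2; omega)) hne
        simp [ih i h3]
      · simp
    rw [h, zero_apply] at h1
    simpa [hx] using h1.symm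

theorem exists_eq_mul_of_b_mul_eq {u z x : ATilde} (hx : x 0 ≠ 0) (h : b * u = z * x) :
    ∃ w, u = w * x := by
  have h0 : z 0 * x 0 = 0 := by rw [← mul_apply_zero, ← h, b_mul_apply_zero]
  obtain ⟨w, rfl⟩ := exists_eq_b_mul ((mul_eq_zero.mp h0).resolve_right hx)
  exact ⟨w, b_mul_left_cancel (by rw [h, mul_assoc])⟩

theorem sub_smul_b_apply_zero (s : ℂ) : (a - s • b) 0 = Polynomial.X := by simp [a, b]

theorem ofB_apply_zero {u : PowerSeries ℂ} (hu : PowerSeries.constantCoeff u = 1) :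
    ofB u 0 = 1 := by
  simp [ofB_apply, hu]

theorem chain_apply_zero (μ : ℕ → ℂ) {U : ℕ → PowerSeries ℂ}
    (hU : ∀ i, PowerSeries.constantCoeff (U i) = 1) (k : ℕ) :
    chain μ U k 0 = Polynomial.X ^ k := by
  induction k with
  | zero => rfl
  | succ k ih =>
    rw [chain_succ, mul_apply_zero, mul_apply_zero, ih, sub_smul_b_apply_zero,
      ofB_apply_zero (hU k), mul_one, pow_succ]

/-- The change of generator that replaces `T` by `T'` in `q T⁻¹ p`. -/
theorem change_generator {p q : ATilde} {S T T' : PowerSeries ℂ}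
    (hT : PowerSeries.constantCoeff T = 1) (hT' : PowerSeries.constantCoeff T' = 1)
    (hS : p * ofB S = ofB S * q + ofB (T' - T)) :
    (∃ r, (q * ofB T'⁻¹ * p) * (1 + ofB S * ofB T⁻¹ * p) = r * (q * ofB T⁻¹ * p)) ∧
      ∃ r, (1 + ofB (-S) * ofB T'⁻¹ * p) * (1 + ofB S * ofB T⁻¹ * p)
        = 1 - r * (q * ofB T⁻¹ * p) := by
  -- The factor `y = 1 + S T⁻¹ p` is chosen so that `p y` equals `T' T⁻¹ p` up to a left multiple of
  -- `q T⁻¹ p`.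
  have h1 : p * (1 + ofB S * ofB T⁻¹ * p)
      = ofB T' * ofB T⁻¹ * p + ofB S * (q * ofB T⁻¹ * p) := by
    have : p * (1 + ofB S * ofB T⁻¹ * p) = p + (p * ofB S) * ofB T⁻¹ * p := by
      rw [mul_add, mul_one]; simp only [mul_assoc]
    rw [this, hS, map_sub, add_mul, sub_mul (ofB T'), ofB_mul_ofB_inv hT]
    noncomm_ring
  have h2 : ofB T'⁻¹ * (p * (1 + ofB S * ofB T⁻¹ * p))
      = ofB T⁻¹ * p + ofB T'⁻¹ * ofB S * (q * ofB T⁻¹ * p) := by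
    rw [h1, mul_add, ← mul_assoc, ← mul_assoc, ofB_inv_mul_ofB hT', one_mul, ← mul_assoc (ofB _)]
  constructor
  · refine ⟨1 + q * (ofB T'⁻¹ * ofB S), ?_⟩
    rw [mul_assoc, mul_assoc, h2]
    simp only [mul_add, add_mul, one_mul, mul_assoc]
  · refine ⟨ofB S * (ofB T'⁻¹ * ofB S), ?_⟩
    rw [add_mul, one_mul, mul_assoc (ofB (-S) * _), mul_assoc (ofB (-S)), h2, map_neg]
    simp only [mul_add, neg_mul, mul_assoc]
    abel

end ATilde

/-! ### Generators, normal submodules and subquotients -/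

namespace ABModule

open ATilde

universe u

variable {E : Type u} [AddCommGroup E] [Module ATilde E]

namespace IsGeneratorWithAnnihilator

/-- Right multiplications by `y` and `y'` induce mutually inverse isomorphisms between `Ã / Ã x'`
and `Ã / Ã x`. -/
theorem change {e : E} {x x' y y' p p' r r' : ATilde} (h : IsGeneratorWithAnnihilator e x)
    (h1 : x' * y = p * x) (h2 : x * y' = p' * x') (h3 : y' * y = 1 - r * x)
    (h4 : y * y' = 1 - r' * x') : IsGeneratorWithAnnihilator (y • e) x' := by
  have hx : ∀ v : ATilde, (v * x) • e = 0 := fun v => (h.2 _).mpr ⟨v, rfl⟩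
  refine ⟨fun z => ?_, fun u => ⟨fun hu => ?_, ?_⟩⟩
  · obtain ⟨u, rfl⟩ := h.1 z
    refine ⟨u * y', ?_⟩
    rw [← mul_smul, mul_assoc, h3, mul_sub, mul_one, ← mul_assoc, sub_smul, hx, sub_zero]
  · rw [← mul_smul] at hu
    obtain ⟨v, hv⟩ := (h.2 _).mp hu
    refine ⟨v * p' + u * r', ?_⟩
    have : u * y * y' = v * p' * x' := by rw [hv, mul_assoc, h2, mul_assoc]
    rw [mul_assoc, h4, mul_sub, mul_one] at this
    rw [add_mul, ← this, mul_assoc u]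
    abel
  · rintro ⟨v, rfl⟩
    rw [← mul_smul, mul_assoc, h1, ← mul_assoc, hx]

theorem nonempty_equiv {e : E} {x : ATilde} (h : IsGeneratorWithAnnihilator e x) :
    Nonempty (E ≃ₗ[ATilde] ATilde ⧸ Submodule.span ATilde {x}) := by
  have hker : LinearMap.ker (LinearMap.toSpanSingleton ATilde E e) = Submodule.span ATilde {x} := by
    ext u
    rw [LinearMap.mem_ker, LinearMap.toSpanSingleton_apply, h.2, Submodule.mem_span_singleton]
    simp only [smul_eq_mul, eq_comm]
  have hsurj : Function.Surjective (LinearMap.toSpanSingleton ATilde E e) := fun z => by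
    obtain ⟨u, rfl⟩ := h.1 z
    exact ⟨u, rfl⟩
  exact ⟨((Submodule.quotEquivOfEq _ _ hker.symm).trans
    (LinearMap.quotKerEquivOfSurjective _ hsurj)).symm⟩

theorem of_ofB_mul {e : E} {x : ATilde} {v : PowerSeries ℂ}
    (hv : PowerSeries.constantCoeff v = 1) (h : IsGeneratorWithAnnihilator e (ofB v * x)) :
    IsGeneratorWithAnnihilator e x := by
  refine ⟨h.1, fun u => (h.2 u).trans ⟨?_, ?_⟩⟩
  · rintro ⟨w, rfl⟩
    exact ⟨w * ofB v, by rw [mul_assoc]⟩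
  · rintro ⟨w, rfl⟩
    exact ⟨w * ofB v⁻¹, by rw [mul_assoc, ← mul_assoc (ofB _), ofB_inv_mul_ofB hv, one_mul]⟩

theorem of_mul_ofB {e : E} {x : ATilde} {v : PowerSeries ℂ}
    (hv : PowerSeries.constantCoeff v = 1) (h : IsGeneratorWithAnnihilator e (x * ofB v)) :
    IsGeneratorWithAnnihilator (ofB v • e) x :=
  h.change (x' := x) (y := ofB v) (y' := ofB v⁻¹) (p := 1) (p' := 1) (r := 0) (r' := 0)
    (by rw [one_mul]) (by rw [mul_assoc, ofB_mul_ofB_inv hv, mul_one, one_mul])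
    (by rw [ofB_inv_mul_ofB hv, zero_mul, sub_zero]) (by rw [ofB_mul_ofB_inv hv, zero_mul, sub_zero])

theorem isNormal_span {e : E} {x y : ATilde} (h : IsGeneratorWithAnnihilator e (x * y))
    (hy : y 0 ≠ 0) : IsNormal (Submodule.span ATilde {y • e}) := by
  intro z hz
  obtain ⟨u, rfl⟩ := h.1 z
  obtain ⟨w, hw⟩ := Submodule.mem_span_singleton.mp hz
  rw [← mul_smul, ← mul_smul, ← sub_eq_zero, ← sub_smul] at hw
  obtain ⟨v, hv⟩ := (h.2 _).mp hw
  have : b * u = (w - v * x) * y := by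
    rw [sub_mul, mul_assoc, ← hv]; abel
  obtain ⟨w', rfl⟩ := exists_eq_mul_of_b_mul_eq hy this
  exact Submodule.mem_span_singleton.mpr ⟨w', by rw [mul_smul]⟩

/-- The subquotient of `E` attached to the middle factor of the annihilator of a generator. -/
theorem subquotient {e : E} {x m y : ATilde} (h : IsGeneratorWithAnnihilator e (x * (m * y)))
    (hy : y 0 ≠ 0) : ∃ f : Submodule.span ATilde {y • e} ⧸
        (Submodule.span ATilde {(m * y) • e}).submoduleOf (Submodule.span ATilde {y • e}),
      IsGeneratorWithAnnihilator f m := by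
  refine ⟨Submodule.Quotient.mk ⟨y • e, Submodule.mem_span_singleton_self _⟩, fun z => ?_,
    fun u => ?_⟩
  · obtain ⟨⟨z, hz⟩, rfl⟩ := Submodule.Quotient.mk_surjective _ z
    obtain ⟨u, rfl⟩ := Submodule.mem_span_singleton.mp hz
    exact ⟨u, rfl⟩
  · rw [← Submodule.Quotient.mk_smul, Submodule.Quotient.mk_eq_zero]
    show u • y • e ∈ Submodule.span ATilde {(m * y) • e} ↔ _
    rw [Submodule.mem_span_singleton]
    constructor
    · rintro ⟨w, hw⟩
      rw [← mul_smul, ← mul_smul, ← sub_eq_zero, ← sub_smul] at hw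
      obtain ⟨v, hv⟩ := (h.2 _).mp hw
      refine ⟨w - v * x, ?_⟩
      rw [← sub_eq_zero]
      refine eq_zero_of_mul_eq_zero hy ?_
      have : (u - (w - v * x) * m) * y = -((w * (m * y) - u * y) - v * (x * (m * y))) := by
        noncomm_ring
      rw [this, hv, sub_self, neg_zero]
    · rintro ⟨v, rfl⟩
      exact ⟨v, by rw [← mul_smul, ← mul_smul, mul_assoc]⟩

end IsGeneratorWithAnnihilator

/-- Changing the generator alters `T = U⁻¹` by `X (euler S + (1 - n) S)`, and these series are
exactly the multiples of `X` with no term in `X ^ n`. Only the constant term and the coefficient of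
`X ^ n` survive. -/
theorem exists_generator_ETwo {e : E} {μ ν : ℂ} {U : PowerSeries ℂ}
    (hU : PowerSeries.constantCoeff U = 1) {n : ℕ} (hn : 1 ≤ n) (hμν : ν + 1 - μ = n)
    (h : IsGeneratorWithAnnihilator e ((a - μ • b) * ofB U * (a - ν • b))) :
    ∃ e' : E, IsGeneratorWithAnnihilator e' ((a - (ν + 1 - n) • b) *
      ofB (1 + PowerSeries.C (PowerSeries.coeff n U⁻¹) * PowerSeries.X ^ n)⁻¹ *
        (a - (ν + 1 - 1) • b)) := by
  set T := U⁻¹ with hT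
  have hUT : U = T⁻¹ := by
    rw [hT, PowerSeries.eq_inv_iff_mul_eq_one (by simp [hU])]
    exact PowerSeries.mul_inv_cancel _ (by simp [hU])
  have hT1 : PowerSeries.constantCoeff T = 1 := by simp [hT, hU]
  set T' : PowerSeries ℂ := 1 + PowerSeries.C (PowerSeries.coeff n T) * PowerSeries.X ^ n with hT'
  have hT'1 : PowerSeries.constantCoeff T' = 1 := by
    simp [hT', show n ≠ 0 by omega]
  obtain rfl : μ = ν + 1 - n := by linear_combination -hμν
  -- At `m + 1 = n` the denominator vanishes, and so does the numerator.
  set S : PowerSeries ℂ := PowerSeries.mk fun m =>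
    PowerSeries.coeff (m + 1) (T' - T) / (m + (ν + 1 - n - ν)) with hS
  have hSeq : PowerSeries.X * (euler S + PowerSeries.C (ν + 1 - n - ν) * S) = T' - T := by
    ext m
    rcases m with _ | m
    · simp [hT1, hT'1]
    · rw [PowerSeries.coeff_succ_X_mul, map_add, coeff_euler, PowerSeries.coeff_C_mul, ← add_mul,
        hS, PowerSeries.coeff_mk]
      by_cases hm : (m : ℂ) + (ν + 1 - n - ν) = 0
      · have : m + 1 = n := by
          have : ((m + 1 : ℕ) : ℂ) = n := by push_cast; linear_combination hm
          exact_mod_cast this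
        subst this
        simp [hT', PowerSeries.coeff_X_pow, PowerSeries.coeff_one]
      · field_simp
  have h1 := sub_mul_ofB ν (ν + 1 - n) S
  rw [hSeq] at h1
  have h2 : (a - ν • b) * ofB (-S) = ofB (-S) * (a - (ν + 1 - n) • b) + ofB (T - T') := by
    rw [map_neg, mul_neg, h1, ← neg_sub T' T, map_neg, neg_add, neg_mul]
  obtain ⟨⟨p, hp⟩, r, hr⟩ := change_generator hT1 hT'1 h1
  obtain ⟨⟨p', hp'⟩, r', hr'⟩ := change_generator hT'1 hT1 h2
  rw [hUT] at h
  rw [add_sub_cancel_right]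
  rw [neg_neg] at hr'
  exact ⟨_, h.change hp hp' hr hr'⟩

/-- With `m` the product of the two factors, take `F = Ã y e` and `G = Ã m y e`: then `F / G` is `Ã
/ Ã m`, and `λ = ν + 1`. -/
theorem hasExceptionalSubquotient {e : E} {μ ν : ℂ} {U : PowerSeries ℂ}
    (hU : PowerSeries.constantCoeff U = 1) {n : ℕ} (hn : 1 ≤ n) (hμν : ν + 1 - μ = n)
    (hα : PowerSeries.coeff n U⁻¹ ≠ 0) {x y : ATilde} (hy : y 0 ≠ 0)
    (h : IsGeneratorWithAnnihilator e (x * ((a - μ • b) * ofB U * (a - ν • b) * y))) :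
    HasExceptionalSubquotient E := by
  set m := (a - μ • b) * ofB U * (a - ν • b) with hm
  have hm0 : (m * y) 0 ≠ 0 := by
    rw [mul_apply_zero, hm, mul_apply_zero, mul_apply_zero, sub_smul_b_apply_zero,
      sub_smul_b_apply_zero, ofB_apply_zero hU]
    simp [hy]
  obtain ⟨f, hf⟩ := h.subquotient hy
  obtain ⟨f', hf'⟩ := exists_generator_ETwo hU hn hμν hf
  refine ⟨ν + 1, PowerSeries.coeff n U⁻¹, n, Submodule.span ATilde {(m * y) • e},
    Submodule.span ATilde {y • e}, hα, hn, ?_, h.isNormal_span hm0, ?_, hf'.nonempty_equiv⟩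
  · rw [Submodule.span_singleton_le_iff_mem, Submodule.mem_span_singleton]
    exact ⟨m, (mul_smul m y e).symm⟩
  · rw [← mul_assoc] at h
    exact h.isNormal_span hy

end ABModule

/-! ### The symbol of the Bernstein perturbation; units inside chains -/

namespace ATilde

theorem a_pow_mul_apply (i : ℕ) (q : ATilde) (n : ℕ) :
    (a ^ i * q) n = Polynomial.X ^ i * q n := by
  induction i with
  | zero => simp
  | succ i ih => rw [pow_succ', mul_assoc, a_mul_apply, ih, pow_succ', mul_assoc]

theorem sum_apply {ι : Type*} (s : Finset ι) (x : ι → ATilde) (n : ℕ) :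
    (∑ i ∈ s, x i) n = ∑ i ∈ s, x i n := by
  classical
  induction s using Finset.induction_on with
  | empty => simp
  | insert i s hi ih => rw [Finset.sum_insert hi, Finset.sum_insert hi, add_apply, ih]

theorem DegreeLT.eq_sum {k : ℕ} {R : ATilde} (h : DegreeLT k R) :
    R = ∑ i ∈ Finset.range k, a ^ i * ofB (PowerSeries.mk fun n => (R n).coeff i) := by
  refine ext' fun n => ?_
  rw [sum_apply]
  simp only [a_pow_mul_apply, ofB_apply, PowerSeries.coeff_mk]
  ext j
  have h1 := Polynomial.coeff_eq_zero_of_degree_lt (n := j) (p := R n)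
  simp only [Polynomial.finsetSum_coeff, Polynomial.coeff_mul_C, Polynomial.coeff_X_pow]
  simp only [ite_mul, one_mul, zero_mul, Finset.sum_ite_eq, Finset.mem_range]
  split_ifs with hj
  · rfl
  · exact h1 ((h n).trans_le (by exact_mod_cast not_lt.mp hj))

theorem HasSymbol.exists_a_pow_mul {m : ℕ} {χ : Polynomial ℂ} {x : ATilde} (h : HasSymbol m χ x)
    (i : ℕ) : ∃ ψ, HasSymbol (m + i) ψ (a ^ i * x) := by
  induction i with
  | zero => exact ⟨χ, by simpa using h⟩
  | succ i ih =>
    obtain ⟨ψ, hψ⟩ := ih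
    exact ⟨_, hψ.a_mul.congr rfl (by rw [pow_succ', mul_assoc])⟩

/-- The valuation gives `R` a symbol of level `k - 1`; one `b` raises the level to `k` and the other
kills the symbol. -/
theorem hasSymbol_b_sq_mul {k : ℕ} {R : ATilde} (hd : DegreeLT k R) (hv : ValuationGE (k - 1) R) :
    HasSymbol k 0 (b ^ 2 * R) := by
  rcases k with _ | k
  · have : R = 0 := by rw [hd.eq_sum]; simp
    rw [this, mul_zero]
    exact HasSymbol.zero 0
  · have h1 : ∀ i ∈ Finset.range (k + 1), ∃ ψ,
        HasSymbol k ψ (a ^ i * ofB (PowerSeries.mk fun n => (R n).coeff i)) := by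
      intro i hi
      have hi' : i ≤ k := by simpa [Nat.lt_succ_iff] using hi
      obtain ⟨g, hg⟩ := (PowerSeries.X_pow_dvd_iff (n := k - i)
        (φ := PowerSeries.mk fun n => (R n).coeff i)).mpr fun m hm => by
          rw [PowerSeries.coeff_mk]; exact hv m i (by omega)
      rw [hg]
      obtain ⟨ψ, hψ⟩ := (HasSymbol.X_pow_mul (k - i) g).exists_a_pow_mul i
      rw [Nat.sub_add_cancel hi'] at hψ
      exact ⟨ψ, hψ⟩
    choose! ψ hψ using h1
    have h2 := HasSymbol.sum _ hψ
    rw [← hd.eq_sum] at h2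
    exact (h2.ofB_mul PowerSeries.X).b_mul.congr (by simp)
      (by rw [← b_eq_ofB, ← mul_assoc, pow_two])

/-- A unit is absorbed by the factor on its left. If there is none it stays in front, where it does
not change the left ideal. -/
theorem chain_mul_ofB {μ : ℕ → ℂ} {U : ℕ → PowerSeries ℂ} {v : PowerSeries ℂ}
    (hU : ∀ i, PowerSeries.constantCoeff (U i) = 1) (hv : PowerSeries.constantCoeff v = 1)
    (k : ℕ) : ∃ (v' : PowerSeries ℂ) (U' : ℕ → PowerSeries ℂ),
      PowerSeries.constantCoeff v' = 1 ∧ (∀ i, PowerSeries.constantCoeff (U' i) = 1) ∧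
        chain μ U k * ofB v = ofB v' * chain μ U' k := by
  rcases k with _ | k
  · exact ⟨v, U, hv, hU, by simp only [chain_zero, one_mul, mul_one]⟩
  · refine ⟨1, Function.update U k (U k * v), by simp, fun i => ?_, ?_⟩
    · rcases eq_or_ne i k with rfl | hi
      · simp [hU, hv]
      · simp [hi, hU]
    · rw [chain_succ, chain_succ, Function.update_self, map_one, one_mul,
        chain_congr (U := Function.update U k (U k * v)) (U' := U) (fun _ _ => rfl)
          (fun i hi => Function.update_of_ne hi.ne _ _), map_mul]
      simp only [mul_assoc]

theorem list_prod_ofFn {M : Type*} [Monoid M] (f : ℕ → M) (k : ℕ) :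
    (List.ofFn fun i : Fin k => f i).prod = ((List.range k).map f).prod := by
  rw [List.ofFn_eq_map, ← List.map_coe_finRange_eq_range, List.map_map]
  rfl

end ATilde

/-! ### Chains and the twisted orbit -/

namespace ABModule

open ATilde

universe u

/-- Extension by zero of a tuple to a sequence. -/
noncomputable def extend {k : ℕ} (μ : Fin k → ℂ) (i : ℕ) : ℂ := if h : i < k then μ ⟨i, h⟩ else 0

@[simp] theorem extend_coe {k : ℕ} (μ : Fin k → ℂ) (i : Fin k) : extend μ i = μ i := by
  simp [extend]

theorem linProd_eq_chain {k : ℕ} (lam : Fin k → ℂ) : linProd lam = chain (extend lam) 1 k := by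
  rw [linProd, chain, ← list_prod_ofFn]
  simp

theorem chainSymbol_extend {k : ℕ} (μ : Fin k → ℂ) : chainSymbol (extend μ) k =
    ∏ i : Fin k, (Polynomial.X - Polynomial.C (μ i + (i : ℕ) + 1 - k)) := by
  rw [chainSymbol, Finset.prod_range]
  simp

/-- The roots depend only on the family of the `λ_i + i`, which the twisted action permutes. -/
theorem chainSymbol_extend_twist {k : ℕ} (σ : Equiv.Perm (Fin k)) (lam : Fin k → ℂ) :
    chainSymbol (extend (twist σ lam)) k = chainSymbol (extend lam) k := by
  rw [chainSymbol_extend, chainSymbol_extend, 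
    ← Equiv.prod_comp σ fun i => Polynomial.X - Polynomial.C (lam i + (i : ℕ) + 1 - k)]
  refine Finset.prod_congr rfl fun i _ => ?_
  rw [twist]
  congr 2
  ring

theorem linProdWith_succ_mul {k : ℕ} (μ : Fin (k + 1) → ℂ) (U : ℕ → PowerSeries ℂ) :
    linProdWith μ (fun i => (U i)⁻¹) * ofB (U k) =
      chain (extend μ) (fun i => (U i)⁻¹⁻¹) k * ((a - μ (Fin.last k) • b) * ofB (U k)) := by
  rw [linProdWith, List.ofFn_succ', List.prod_concat, chain, ← list_prod_ofFn]
  have h1 : ∀ i : Fin k, extend μ i = μ i.castSucc := fun i => extend_coe μ i.castSucc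
  simp [h1, mul_assoc]

/-- Setting `b = 0` leaves `X ^ k` on one side and `X ^ r` on the other. This identifies the rank of
`E` with the number of factors. -/
theorem eq_of_isMonicHomogeneous {k r : ℕ} {lam : Fin k → ℂ}
    (h : IsMonicHomogeneous r (linProd lam)) : r = k := by
  obtain ⟨c, hc, hP⟩ := h
  have h1 := congrArg (fun x : ATilde => x 0) hP
  rw [linProd_eq_chain] at h1
  simp only [chain_apply_zero _ (U := 1) (by simp), sum_apply, smul_apply, a_pow_mul_apply] at h1
  have hb : ∀ m, m ≠ 0 → (b ^ m) 0 = 0 := by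
    intro m hm
    obtain ⟨m, rfl⟩ := Nat.exists_eq_succ_of_ne_zero hm
    rw [pow_succ', b_mul_apply_zero]
  rw [Finset.sum_eq_single r, hc, Nat.sub_self, pow_zero, one_apply] at h1
  · simpa using (congrArg Polynomial.natDegree h1).symm
  · intro j hj hne
    rw [hb _ (by simp at hj; omega), mul_zero, smul_zero]
  · simp

variable {E : Type u} [AddCommGroup E] [Module ATilde E]

theorem IsBernsteinElement.exists_hasSymbol {k : ℕ} {lam : Fin k → ℂ}
    (h : IsBernsteinElement E (linProd lam)) : ∃ (x : ATilde) (e : E),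
      HasSymbol k (chainSymbol (extend lam) k) x ∧ IsGeneratorWithAnnihilator e x := by
  obtain ⟨h1, R, hd, hv, e, he⟩ := h
  rw [eq_of_isMonicHomogeneous h1] at hd hv
  refine ⟨_, e, ?_, he⟩
  rw [linProd_eq_chain]
  simpa using (hasSymbol_chain (extend lam) k).add (hasSymbol_b_sq_mul hd hv)

variable (E) in
/-- `E` has a generator annihilated by a product `(a - μ₀ b) U₀ ⋯ (a - μₖ₋₁ b) Uₖ₋₁`, with
`Uᵢ(0) = 1`. -/
def HasChain (μ : ℕ → ℂ) (k : ℕ) : Prop :=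
  ∃ U : ℕ → PowerSeries ℂ, (∀ i, PowerSeries.constantCoeff (U i) = 1) ∧
    ∃ e : E, IsGeneratorWithAnnihilator e (chain μ U k)

theorem HasChain.congr {μ μ' : ℕ → ℂ} {k : ℕ} (h : HasChain E μ k) (hμ : ∀ i < k, μ i = μ' i) :
    HasChain E μ' k := by
  obtain ⟨U, hU, e, he⟩ := h
  exact ⟨U, hU, e, chain_congr hμ (fun _ _ => rfl) ▸ he⟩

theorem IsBernsteinElement.hasChain {k : ℕ} {lam : Fin k → ℂ}
    (h : IsBernsteinElement E (linProd lam)) (σ : Equiv.Perm (Fin k))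
    (hσ : IsOrdered (twist σ lam)) : HasChain E (extend (twist σ lam)) k := by
  obtain ⟨x, e, hx, he⟩ := h.exists_hasSymbol
  rw [← chainSymbol_extend_twist σ] at hx
  obtain ⟨U, v, hU, hv, rfl⟩ := hx.exists_eq_chain fun i j hij hj => by
    have := hσ ⟨i, by omega⟩ ⟨j, hj⟩ hij
    simp only [extend, hj, show i < k by omega, dif_pos]
    simp only at this
    linarith
  exact ⟨U, hU, e, he.of_ofB_mul hv⟩

theorem HasChain.exists_linProdWith {k : ℕ} {μ : Fin k → ℂ} (h : HasChain E (extend μ) k) :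
    ∃ T : Fin (k - 1) → PowerSeries ℂ, (∀ j, PowerSeries.constantCoeff (T j) = 1) ∧
      ∃ e : E, IsGeneratorWithAnnihilator e (linProdWith μ T) := by
  obtain ⟨U, hU, e, he⟩ := h
  refine ⟨fun i => (U i)⁻¹, fun j => by simp [hU], ?_⟩
  rcases k with _ | k
  · exact ⟨e, by simpa [linProdWith, chain_zero] using he⟩
  · have hinv : (fun i => (U i)⁻¹⁻¹) = U := by
      funext i
      have h1 : PowerSeries.constantCoeff (U i)⁻¹ ≠ 0 := by simp [hU]
      rw [eq_comm, PowerSeries.eq_inv_iff_mul_eq_one h1]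
      exact PowerSeries.mul_inv_cancel _ (by simp [hU])
    have h1 := linProdWith_succ_mul μ U
    rw [hinv, ← extend_coe μ, Fin.val_last, ← chain_succ] at h1
    -- The last unit of the chain has no counterpart in `linProdWith`; it is moved into the
    -- generator.
    exact ⟨_, (h1 ▸ he).of_mul_ofB (hU k)⟩

theorem HasChain.swap (hE : ¬ HasExceptionalSubquotient E) {μ : ℕ → ℂ} {i r : ℕ}
    (h : HasChain E μ (i + 2 + r)) :
    HasChain E (fun j => if j = i then μ (i + 1) + 1 else if j = i + 1 then μ i - 1 else μ j)
      (i + 2 + r) := by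
  obtain ⟨U, hU, e, he⟩ := h
  have hsplit : chain μ U (i + 2 + r) = chain μ U i * ((a - μ i • b) * ofB (U i) *
      (a - μ (i + 1) • b) * (ofB (U (i + 1)) *
        chain (fun j => μ (i + 2 + j)) (fun j => U (i + 2 + j)) r)) := by
    rw [chain_add, chain_succ, chain_succ]
    simp only [mul_assoc]
  rw [hsplit] at he
  have hn : ∀ n : ℕ, 1 ≤ n → μ (i + 1) + 1 - μ i = n → PowerSeries.coeff n (U i)⁻¹ = 0 := by
    intro n hn hμ
    by_contra hα
    refine hE (hasExceptionalSubquotient (hU i) hn hμ hα ?_ he)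
    rw [mul_apply_zero, ofB_apply_zero (hU _), chain_apply_zero _ (fun j => hU _), one_mul]
    exact pow_ne_zero _ Polynomial.X_ne_zero
  obtain ⟨v, w, z, hv, hw, hz, hswap⟩ := exists_swap (hU i) hn
  obtain ⟨v', U', hv', hU', hvU⟩ := chain_mul_ofB (μ := μ) hU hv i
  -- The unit `v` left of the exchanged pair has gone into the factors before `i`, giving `U'`; `z`
  -- on its right joins the next unit.
  set V : ℕ → PowerSeries ℂ := fun j => if j = i then w else if j = i + 1 then z * U (i + 1)
    else if j < i then U' j else U j with hV
  have hVc : ∀ j, PowerSeries.constantCoeff (V j) = 1 := by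
    intro j
    simp only [hV]
    split_ifs <;> simp [hw, hz, hU, hU']
  refine ⟨V, hVc, e, IsGeneratorWithAnnihilator.of_ofB_mul hv' ?_⟩
  set M : ℕ → ℂ := fun j =>
    if j = i then μ (i + 1) + 1 else if j = i + 1 then μ i - 1 else μ j with hM
  have hlow : chain M V i = chain μ U' i := chain_congr
    (fun j hj => by simp only [hM]; rw [if_neg (by omega), if_neg (by omega)])
    (fun j hj => by simp only [hV]; rw [if_neg (by omega), if_neg (by omega), if_pos hj])
  have hhigh : chain (fun j => M (i + 2 + j)) (fun j => V (i + 2 + j)) r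
      = chain (fun j => μ (i + 2 + j)) (fun j => U (i + 2 + j)) r := chain_congr
    (fun j hj => by simp only [hM]; rw [if_neg (by omega), if_neg (by omega)])
    (fun j hj => by
      simp only [hV]; rw [if_neg (by omega), if_neg (by omega), if_neg (by omega)])
  have hM0 : M i = μ (i + 1) + 1 := by simp [hM]
  have hM1 : M (i + 1) = μ i - 1 := by simp [hM]
  have hV0 : V i = w := by simp [hV]
  have hV1 : V (i + 1) = z * U (i + 1) := by simp [hV]
  have h1 : ofB v' * chain M V (i + 2 + r) = chain μ U i * ((a - μ i • b) * ofB (U i) *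
      (a - μ (i + 1) • b) * (ofB (U (i + 1)) *
        chain (fun j => μ (i + 2 + j)) (fun j => U (i + 2 + j)) r)) := by
    rw [hswap, chain_add, chain_succ, chain_succ, hlow, hhigh, hM0, hM1, hV0, hV1, map_mul]
    simp only [← mul_assoc]
    rw [hvU]
  rwa [h1]

/-- The exchange `(μ_i, μ_{i+1}) ↦ (μ_{i+1} + 1, μ_i - 1)` is the twisted action of an adjacent
transposition. -/
theorem HasChain.twist_swap (hE : ¬ HasExceptionalSubquotient E) {k : ℕ} {lam : Fin (k + 1) → ℂ}
    {σ : Equiv.Perm (Fin (k + 1))} (h : HasChain E (extend (twist σ lam)) (k + 1)) (i : Fin k) :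
    HasChain E (extend (twist (σ * Equiv.swap i.castSucc i.succ) lam)) (k + 1) := by
  obtain ⟨r, hr⟩ : ∃ r, k + 1 = i + 2 + r := ⟨k + 1 - (i + 2), by omega⟩
  have h1 : HasChain E (extend (twist σ lam)) (i + 2 + r) := hr ▸ h
  have h2 := h1.swap hE
  rw [← hr] at h2
  refine h2.congr fun j hj => ?_
  have e0 : extend (twist σ lam) i = _ := extend_coe _ i.castSucc
  have e1 : extend (twist σ lam) (i + 1) = _ := extend_coe _ i.succ
  obtain ⟨j, rfl⟩ : ∃ j' : Fin (k + 1), (j' : ℕ) = j := ⟨⟨j, hj⟩, rfl⟩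
  rw [e0, e1, extend_coe, extend_coe]
  simp only [twist, Equiv.Perm.mul_apply]
  split_ifs with c0 c1
  · obtain rfl : j = i.castSucc := Fin.ext c0
    rw [Equiv.swap_apply_left]
    simp
    ring
  · obtain rfl : j = i.succ := Fin.ext c1
    rw [Equiv.swap_apply_right]
    simp
    ring
  · rw [Equiv.swap_apply_of_ne_of_ne]
    · rintro rfl; exact c0 rfl
    · rintro rfl; exact c1 rfl

theorem HasChain.twist (hE : ¬ HasExceptionalSubquotient E) {k : ℕ} {lam : Fin k → ℂ}
    {σ : Equiv.Perm (Fin k)} (h : HasChain E (extend (twist σ lam)) k) (τ : Equiv.Perm (Fin k)) :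
    HasChain E (extend (ABModule.twist τ lam)) k := by
  rcases k with _ | k
  · rwa [Subsingleton.elim τ σ]
  -- Quantifying over the starting `σ` makes the property of `π` stable under products, so adjacent
  -- transpositions suffice.
  · have key : ∀ π : Equiv.Perm (Fin (k + 1)), ∀ σ : Equiv.Perm (Fin (k + 1)),
        HasChain E (extend (ABModule.twist σ lam)) (k + 1) →
          HasChain E (extend (ABModule.twist (σ * π) lam)) (k + 1) := by
      intro π
      have hπ : π ∈ Submonoid.closure
          (Set.range fun i : Fin k => Equiv.swap i.castSucc i.succ) := by
        rw [Equiv.Perm.mclosure_swap_castSucc_succ]; trivial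
      induction hπ using Submonoid.closure_induction with
      | mem π hπ =>
        obtain ⟨i, rfl⟩ := hπ
        exact fun σ hσ => hσ.twist_swap hE i
      | one => exact fun σ hσ => by rwa [mul_one]
      | mul π ρ _ _ h1 h2 => exact fun σ hσ => by rw [← mul_assoc]; exact h2 _ (h1 _ hσ)
    simpa using key (σ⁻¹ * τ) σ h

theorem exists_isOrdered_twist {k : ℕ} (lam : Fin k → ℂ) :
    ∃ σ : Equiv.Perm (Fin k), IsOrdered (twist σ lam) := by
  refine ⟨Tuple.sort fun i : Fin k => (lam i).re + (i : ℕ), fun i j hij => ?_⟩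
  have := Tuple.monotone_sort (fun i : Fin k => (lam i).re + (i : ℕ)) hij
  simp only [Function.comp_apply] at this
  simp only [twist, Complex.sub_re, Complex.add_re, Complex.natCast_re]
  linarith

end ABModule

theorem mainTheorem10 {E : Type*} [AddCommGroup E] [Module ATilde E]
    (hreg : ABModule.IsRegular E) (hmono : ABModule.IsMonogenic E)
    {k : ℕ} (lam : Fin k → ℂ)
    (hP : ABModule.IsBernsteinElement E (ABModule.linProd lam)) :
    (∀ μ ∈ ABModule.twistedOrbit lam, ABModule.IsOrdered μ →
      ∃ T : Fin (k - 1) → PowerSeries ℂ, (∀ j, PowerSeries.constantCoeff (T j) = 1) ∧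
        ∃ e : E, ABModule.IsGeneratorWithAnnihilator e (ABModule.linProdWith μ T)) ∧
    (¬ ABModule.HasExceptionalSubquotient E →
      ∀ ν ∈ ABModule.twistedOrbit lam,
        ∃ X : Fin (k - 1) → PowerSeries ℂ, (∀ j, PowerSeries.constantCoeff (X j) = 1) ∧
          ∃ e : E, ABModule.IsGeneratorWithAnnihilator e (ABModule.linProdWith ν X)) := by
  constructor
  · rintro μ ⟨σ, rfl⟩ hσ
    exact (hP.hasChain σ hσ).exists_linProdWith
  · rintro hE ν ⟨τ, rfl⟩
    obtain ⟨σ, hσ⟩ := ABModule.exists_isOrdered_twist lam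
    exact ((hP.hasChain σ hσ).twist hE τ).exists_linProdWith
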